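/- Let $R$ be a finite commutative local ring with identity in which every ideal is principal. Let $\pi$ be a generator of its maximal ideal, let $q=|R/(\pi)|$ be the size of the residue field, assumed to be odd, and let $\ell$ be the smallest positive integer with $\pi^\ell=0$. Let $R^{n,u}\subseteq R^n$ be the set of unimodular $n$-tuples, i.e. the tuples whose entries generate $R$ as an ideal, and write $a\cdot b=a_1b_1+\dots+a_nb_n$. For $n\ge 2$, let $\mathrm{Um}(R^n)$ be the bipartite graph on two copies of $R^{n,u}$ in which a vertex $a$ of the first copy and a vertex $b$ of the second copy are adjacent whenever $a\cdot b=1$. For $n\ge 3$, let $\mathrm{Um}_0(R^n)$ be the bipartite graph on two copies of $R^{n,u}/R^\times$ in which a vertex $[a]$ of the first copy and a vertex $[b]$ of the second copy are adjacent whenever $a\cdot b=0$. The isoperimetric constant of a finite graph $X$ is $$\mathrm{iso}(X)=\min\frac{e(U,W)}{\min\{|U|,|W|\}},$$ where the minimum is over all partitions of the vertex set of $X$ into two non-empty sets $U$ and $W$, and $e(U,W)$ is the number of edges joining a vertex of $U$ to a vertex of $W$. For $n\ge 2$, the isoperimetric constant of $\mathrm{Um}(R^n)$ satisfies $$\mathrm{iso}\big(\mathrm{Um}(R^n)\big)=\tfrac12\,q^{(n-1)\ell}\big(1-q^{-(n-1)/2}\big)\quad\text{when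 } n \text{ is odd},$$ $$\tfrac12\,q^{(n-1)\ell}\big(1-q^{-n/2}\big)\ \ge\ \mathrm{iso}\big(\mathrm{Um}(R^n)\big)\ \ge\ \tfrac12\,q^{(n-1)\ell}\big(1-q^{-(n-1)/2}\big)\quad\text{when } n \text{ is even}.$$ For $n\ge 3$, the isoperimetric constant of $\mathrm{Um}_0(R^n)$ satisfies $$\mathrm{iso}\big(\mathrm{Um}_0(R^n)\big)\ \ge\ \tfrac12\,q^{(n-2)(\ell-1)}\Big(\frac{q^{n-1}-1}{q-1}-q^{n/2-1}\Big)\quad\text{when } n \text{ is odd},$$ $$\mathrm{iso}\big(\mathrm{Um}_0(R^n)\big)=\tfrac12\,q^{(n-2)(\ell-1)}\Big(\frac{q^{n-1}-1}{q-1}-q^{n/2-1}\Big)\quad\text{when } n \text{ is even}.$$ -/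

import Mathlib

/-- The unimodular `n`-tuples over `R`, i.e. the tuples whose entries generate `R` as an ideal,
together with the scaling action of `Rˣ` on them. -/
def unimodularTuples (R : Type*) [CommRing R] (n : ℕ) : SubMulAction Rˣ (Fin n → R) where
  carrier := {a | Ideal.span (Set.range a) = ⊤}
  smul_mem' := by
    intro u a ha
    simp only [Set.mem_ofPred_eq, Ideal.eq_top_iff_one] at ha ⊢
    have hle : Ideal.span (Set.range a) ≤ Ideal.span (Set.range (u • a)) := by
      rw [Ideal.span_le]
      rintro _ ⟨i, rfl⟩
      have h1 : (u • a) i ∈ Ideal.span (Set.range (u • a)) := Ideal.subset_span ⟨i, rfl⟩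
      have h2 := Ideal.mul_mem_left _ ((u⁻¹ : Rˣ) : R) h1
      simpa [Pi.smul_apply, Units.smul_def] using h2
    exact hle ha

/-- The projective set `R^{n,u} / Rˣ` of unimodular tuples up to multiplication by units. -/
abbrev ProjUnimodular (R : Type*) [CommRing R] (n : ℕ) : Type _ :=
  MulAction.orbitRel.Quotient Rˣ (unimodularTuples R n)

/-- Orthogonality `a ⬝ b = 0` of two classes of unimodular tuples. -/
def ProjUnimodular.Orthogonal {R : Type*} [CommRing R] {n : ℕ} (x y : ProjUnimodular R n) : Prop :=
  Quotient.liftOn₂ x y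
    (fun a b : unimodularTuples R n => (a : Fin n → R) ⬝ᵥ (b : Fin n → R) = 0) (by
      rintro a b c d ⟨u, hu⟩ ⟨v, hv⟩
      have hu' : (u • (c : Fin n → R)) = a := by rw [← hu]; rfl
      have hv' : (v • (d : Fin n → R)) = b := by rw [← hv]; rfl
      rw [← hu', ← hv', smul_dotProduct, dotProduct_smul, smul_eq_zero_iff_eq,
        smul_eq_zero_iff_eq])

/-- The bipartite graph on two copies of `V` in which the vertex `a` of the first copy and the
vertex `b` of the second copy are adjacent whenever `r a b`. -/
def bipartiteGraphOf {V : Type*} (r : V → V → Prop) : SimpleGraph (V ⊕ V) where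
  Adj
    | Sum.inl a, Sum.inr b => r a b
    | Sum.inr b, Sum.inl a => r a b
    | _, _ => False
  symm := ⟨by rintro (a | a) (b | b) h <;> exact h⟩
  loopless := ⟨by rintro (a | a) h <;> exact h⟩

/-- The unimodular graph `Um(R^n)`: the bipartite graph on two copies of the set of unimodular
`n`-tuples, with `a` and `b` adjacent whenever `a ⬝ b = 1`. -/
def Um (R : Type*) [CommRing R] (n : ℕ) :
    SimpleGraph (unimodularTuples R n ⊕ unimodularTuples R n) :=
  bipartiteGraphOf fun a b => (a : Fin n → R) ⬝ᵥ (b : Fin n → R) = 1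

/-- The unimodular graph `Um₀(R^n)`: the bipartite graph on two copies of `R^{n,u} / Rˣ`,
with `[a]` and `[b]` adjacent whenever `a ⬝ b = 0`. -/
def Um₀ (R : Type*) [CommRing R] (n : ℕ) :
    SimpleGraph (ProjUnimodular R n ⊕ ProjUnimodular R n) :=
  bipartiteGraphOf ProjUnimodular.Orthogonal

namespace SimpleGraph

/-- The number `e(U, W)` of edges between vertices of `U` and vertices of `W`
(for disjoint `U` and `W`). -/
noncomputable def edgesBetween {V : Type*} (G : SimpleGraph V) (U W : Set V) : ℕ :=
  {p : V × V | p.1 ∈ U ∧ p.2 ∈ W ∧ G.Adj p.1 p.2}.ncard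

/-- The set of quotients `e(U, W) / min {|U|, |W|}`, over all partitions of the vertices into two
non-empty sets `U` and `W`. -/
def isoRatios {V : Type*} (G : SimpleGraph V) : Set ℝ :=
  {x | ∃ U W : Set V, U.Nonempty ∧ W.Nonempty ∧ IsCompl U W ∧
    x = (G.edgesBetween U W : ℝ) / (min U.ncard W.ncard : ℕ)}

/-- The isoperimetric constant of a finite graph. The infimum is a minimum as soon as there are at
least two vertices, see `isLeast_iso`. -/
noncomputable def iso {V : Type*} (G : SimpleGraph V) : ℝ :=
  sInf G.isoRatios

theorem isLeast_iso {V : Type*} [Finite V] [Nontrivial V] (G : SimpleGraph V) :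
    IsLeast G.isoRatios G.iso := by
  have hfin : G.isoRatios.Finite := by
    refine (Set.finite_range fun p : Set V × Set V =>
      (G.edgesBetween p.1 p.2 : ℝ) / (min p.1.ncard p.2.ncard : ℕ)).subset ?_
    rintro x ⟨U, W, -, -, -, rfl⟩
    exact ⟨(U, W), rfl⟩
  have hne : G.isoRatios.Nonempty := by
    obtain ⟨a, b, hab⟩ := exists_pair_ne V
    exact ⟨_, {a}, {a}ᶜ, ⟨a, rfl⟩, ⟨b, hab.symm⟩, isCompl_compl, rfl⟩
  exact ⟨hne.csInf_mem hfin, fun x hx => csInf_le hfin.bddBelow hx⟩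

end SimpleGraph

/-! Both graphs are regular and bipartite, of some degree `d`, so a cut is governed by the bilinear
form of the biadjacency matrix `A` on functions of mean zero. If `A` has norm at most `λ` there,
then `iso ≥ (d - λ)/2` (`le_iso_bipartiteGraphOf`). Conversely, balanced sign functions `f`, `g`
with `|⟨f, A g⟩| = λ |V|` cut the vertices into equal halves and give `iso ≤ (d - λ)/2`
(`iso_bipartiteGraphOf_le`).

The norm is read off from `A Aᵀ`, whose entries count common neighbours, that is, solutions of two
linear equations. Put `M = |𝔪|`, with `𝔪` the maximal ideal. In `Um`, two tuples that are not
proportional modulo `𝔪` have exactly `(qM)^(n-2)` common neighbours, so `A Aᵀ` is that multiple of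
all-ones minus "same line", plus a nonnegative remainder. In `Um₀` the number of common neighbours
is at least its value for independent lines. In either case the constant part dies on mean-zero
functions, and the row sums of the remainder bound the norm (`two_mul_sum_ite_mul_le`).

For the upper bounds, identify `kⁿ`, `k` the residue field, with its extension `L` of degree `n` in
two ways, by a basis and by its trace-dual basis, so that the dot product becomes the trace of a
product. The signs are the quadratic character of `L`, pulled back along reduction. The form then
reduces to `S(c)`, the sum of the character over the elements of trace `c`, evaluated by Gauss sums:
`S(1)² = q^(n-1)` for `n` odd; `S(1)² = q^(n-2)` and `S(0) = -(q-1) S(1)` for `n` even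
(`quadraticTraceSum_one_sq_of_odd`, `quadraticTraceSum_of_even`). This meets the spectral bound for
`Um` when `n` is odd and for `Um₀` when `n` is even. Oddness of `q` enters only here. -/

/-! ### Cuts of a bipartite graph as quadratic forms -/

open scoped Classical in
theorem edgesBetween_bipartiteGraphOf {V : Type*} [Fintype V] (r : V → V → Prop)
    {U W : Set (V ⊕ V)} (h : IsCompl U W) :
    ((bipartiteGraphOf r).edgesBetween U W : ℝ) =
      ∑ a, ∑ b, if r a b then
        ((if Sum.inl a ∈ U then 1 else 0) - (if Sum.inr b ∈ U then 1 else 0) : ℝ) ^ 2 else 0 := by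
  obtain rfl : W = Uᶜ := h.compl_eq.symm
  have key : {p : (V ⊕ V) × (V ⊕ V) | p.1 ∈ U ∧ p.2 ∈ Uᶜ ∧ (bipartiteGraphOf r).Adj p.1 p.2}.ncard
      = ({p : V × V | r p.1 p.2 ∧ ¬ (Sum.inl p.1 ∈ U ↔ Sum.inr p.2 ∈ U)} : Set (V × V)).ncard := by
    symm
    -- A cut edge is recorded once, with its endpoint in `U` listed first.
    refine Set.ncard_congr (fun p _ => if Sum.inl p.1 ∈ U then (Sum.inl p.1, Sum.inr p.2)
      else (Sum.inr p.2, Sum.inl p.1)) ?_ ?_ ?_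
    · rintro ⟨a, b⟩ ⟨hr, hn⟩
      by_cases ha : Sum.inl a ∈ U
      · simp only [ha, if_true, true_iff] at hn ⊢
        exact ⟨ha, hn, hr⟩
      · simp only [ha, if_false, false_iff, not_not] at hn ⊢
        exact ⟨hn, ha, hr⟩
    · rintro ⟨a, b⟩ ⟨a', b'⟩ ⟨hr, hn⟩ ⟨hr', hn'⟩ heq
      dsimp only at heq
      split_ifs at heq <;> simp_all
    · rintro ⟨a | a, b | b⟩ ⟨h1, h2, h3⟩
      · exact h3.elim
      · refine ⟨(a, b), ⟨h3, ?_⟩, ?_⟩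
        · simp_all
        · simp_all
      · refine ⟨(b, a), ⟨h3, ?_⟩, ?_⟩
        · simp_all
        · simp_all
      · exact h3.elim
  rw [SimpleGraph.edgesBetween, key, Set.ncard_eq_toFinset_card', ← Finset.sum_product',
    Finset.card_eq_sum_ones, Nat.cast_sum]
  simp only [Nat.cast_one]
  rw [← Finset.sum_filter_add_sum_filter_not (Finset.univ ×ˢ Finset.univ)
    (fun p : V × V => r p.1 p.2 ∧ ¬ (Sum.inl p.1 ∈ U ↔ Sum.inr p.2 ∈ U))]
  rw [Finset.sum_eq_zero (s := Finset.filter (fun p : V × V =>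
    ¬ (r p.1 p.2 ∧ ¬ (Sum.inl p.1 ∈ U ↔ Sum.inr p.2 ∈ U))) _), add_zero]
  · refine Finset.sum_congr ?_ ?_
    · ext p; simp
    · rintro ⟨a, b⟩ hp
      replace hp : r a b ∧ ¬ (Sum.inl a ∈ U ↔ Sum.inr b ∈ U) := (Finset.mem_filter.1 hp).2
      by_cases ha : Sum.inl a ∈ U <;> by_cases hb : Sum.inr b ∈ U <;> simp_all
  · rintro ⟨a, b⟩ hp
    by_cases ha : Sum.inl a ∈ U <;> by_cases hb : Sum.inr b ∈ U <;> simp_all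

theorem edgesBetween_comm {V : Type*} (G : SimpleGraph V) (U W : Set V) :
    G.edgesBetween U W = G.edgesBetween W U := by
  refine Set.ncard_congr (fun p _ => p.swap) ?_ ?_ ?_
  · rintro ⟨a, b⟩ ⟨h1, h2, h3⟩
    exact ⟨h2, h1, h3.symm⟩
  · rintro p p' _ _ h
    exact Prod.swap_injective h
  · rintro ⟨a, b⟩ ⟨h1, h2, h3⟩
    exact ⟨(b, a), ⟨h2, h1, h3.symm⟩, rfl⟩

open scoped Classical in
theorem ncard_sum_eq {V : Type*} [Fintype V] (U : Set (V ⊕ V)) :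
    (U.ncard : ℝ) = ∑ a, (if Sum.inl a ∈ U then 1 else 0 : ℝ) +
      ∑ b, (if Sum.inr b ∈ U then 1 else 0 : ℝ) := by
  rw [Set.ncard_eq_toFinset_card', ← Fintype.sum_sumElim, Finset.sum_congr rfl
    (g := fun x => if x ∈ U then (1 : ℝ) else 0) (by rintro (a | a) _ <;> rfl)]
  simp [Set.toFinset_card]

theorem ncard_compl_sum {V : Type*} [Fintype V] (U : Set (V ⊕ V)) :
    (U.ncard : ℝ) + (Uᶜ.ncard : ℝ) = 2 * Fintype.card V := by
  have := Set.ncard_add_ncard_compl U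
  rw [Nat.card_eq_fintype_card, Fintype.card_sum] at this
  rw [← Nat.cast_add, this]; push_cast; ring

instance nontrivial_sum {V : Type*} [Nonempty V] : Nontrivial (V ⊕ V) :=
  ⟨⟨Sum.inl (Classical.arbitrary V), Sum.inr (Classical.arbitrary V), Sum.inl_ne_inr⟩⟩

/-! ### Spectral bounds for regular bipartite graphs -/

section Regular

variable {V : Type*} [Fintype V] (r : V → V → Prop) [∀ a b, Decidable (r a b)] {d : ℝ}

theorem sum_ite_sub_sq (hd : ∀ a, ∑ b, (if r a b then 1 else 0 : ℝ) = d)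
    (hd' : ∀ b, ∑ a, (if r a b then 1 else 0 : ℝ) = d) (x y : V → ℝ) :
    ∑ a, ∑ b, (if r a b then (x a - y b) ^ 2 else 0) =
      d * (∑ a, x a ^ 2 + ∑ b, y b ^ 2) - 2 * ∑ a, ∑ b, (if r a b then x a * y b else 0) := by
  have h1 : ∑ a, ∑ b, (if r a b then x a ^ 2 else 0) = d * ∑ a, x a ^ 2 := by
    rw [Finset.mul_sum]
    refine Finset.sum_congr rfl fun a _ => ?_
    rw [← hd a, Finset.sum_mul]
    exact Finset.sum_congr rfl fun b _ => by split_ifs <;> simp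
  have h2 : ∑ a, ∑ b, (if r a b then y b ^ 2 else 0) = d * ∑ b, y b ^ 2 := by
    rw [Finset.sum_comm, Finset.mul_sum]
    refine Finset.sum_congr rfl fun a _ => ?_
    rw [← hd' a, Finset.sum_mul]
    exact Finset.sum_congr rfl fun b _ => by split_ifs <;> simp
  rw [mul_add, ← h1, ← h2, Finset.mul_sum, ← Finset.sum_add_distrib, ← Finset.sum_sub_distrib]
  refine Finset.sum_congr rfl fun a _ => ?_
  rw [Finset.mul_sum, ← Finset.sum_add_distrib, ← Finset.sum_sub_distrib]
  refine Finset.sum_congr rfl fun b _ => ?_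
  split_ifs <;> ring

/-- Splitting off the means of `x` and `y` in the bilinear form of a regular bipartite graph. -/
theorem sum_ite_mul_add_const (hd : ∀ a, ∑ b, (if r a b then 1 else 0 : ℝ) = d)
    (hd' : ∀ b, ∑ a, (if r a b then 1 else 0 : ℝ) = d) (f g : V → ℝ)
    (hf : ∑ a, f a = 0) (hg : ∑ b, g b = 0) (s t : ℝ) :
    ∑ a, ∑ b, (if r a b then (s + f a) * (t + g b) else 0) =
      d * Fintype.card V * (s * t) + ∑ a, ∑ b, (if r a b then f a * g b else 0) := by
  have h1 : ∑ a, ∑ b, (if r a b then f a * t else 0) = 0 := by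
    have : ∀ a, ∑ b, (if r a b then f a * t else 0) = f a * (t * d) := fun a => by
      rw [← hd a, Finset.mul_sum, Finset.mul_sum]
      exact Finset.sum_congr rfl fun b _ => by split_ifs <;> simp
    simp only [this, ← Finset.sum_mul, hf, zero_mul]
  have h2 : ∑ a, ∑ b, (if r a b then s * g b else 0) = 0 := by
    have : ∀ b, ∑ a, (if r a b then s * g b else 0) = g b * (s * d) := fun b => by
      rw [← hd' b, Finset.mul_sum, Finset.mul_sum]
      exact Finset.sum_congr rfl fun b _ => by split_ifs <;> simp [mul_comm]
    rw [Finset.sum_comm]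
    simp only [this, ← Finset.sum_mul, hg, zero_mul]
  have h3 : ∑ a, ∑ b, (if r a b then s * t else 0) = d * Fintype.card V * (s * t) := by
    have : ∀ a, ∑ b, (if r a b then s * t else 0) = d * (s * t) := fun a => by
      rw [← hd a, Finset.sum_mul]
      exact Finset.sum_congr rfl fun b _ => by split_ifs <;> simp
    simp only [this, Finset.sum_const, Finset.card_univ, nsmul_eq_mul]; ring
  calc ∑ a, ∑ b, (if r a b then (s + f a) * (t + g b) else 0)
      = ∑ a, ∑ b, ((if r a b then s * t else 0) + (if r a b then f a * t else 0) +
          (if r a b then s * g b else 0) + (if r a b then f a * g b else 0)) := by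
        refine Finset.sum_congr rfl fun a _ => Finset.sum_congr rfl fun b _ => ?_
        split_ifs <;> ring
    _ = _ := by simp only [Finset.sum_add_distrib, h1, h2, h3, add_zero]

/-- The spectral lower bound for the isoperimetric constant of a regular bipartite graph. -/
theorem le_iso_bipartiteGraphOf [Nonempty V] {lam : ℝ}
    (hd : ∀ a, ∑ b, (if r a b then 1 else 0 : ℝ) = d)
    (hd' : ∀ b, ∑ a, (if r a b then 1 else 0 : ℝ) = d) (hlam : 0 ≤ lam) (hlam' : lam ≤ d)
    (hspec : ∀ f g : V → ℝ, ∑ a, f a = 0 → ∑ b, g b = 0 →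
      2 * ∑ a, ∑ b, (if r a b then f a * g b else 0) ≤ lam * (∑ a, f a ^ 2 + ∑ b, g b ^ 2)) :
    (d - lam) / 2 ≤ (bipartiteGraphOf r).iso := by
  classical
  have hN : (0 : ℝ) < Fintype.card V := by exact_mod_cast Fintype.card_pos
  set N : ℝ := ((Fintype.card V : ℕ) : ℝ) with hNdef
  -- It is enough to treat the smaller side, which has at most `N` of the `2N` vertices.
  have main : ∀ U W : Set (V ⊕ V), IsCompl U W → U.ncard ≤ W.ncard →
      (d - lam) / 2 * U.ncard ≤ (bipartiteGraphOf r).edgesBetween U W := by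
    intro U W hUW hle
    obtain rfl : W = Uᶜ := hUW.compl_eq.symm
    have hle' : (U.ncard : ℝ) ≤ N := by
      have h1 := ncard_compl_sum U
      have h2 : (U.ncard : ℝ) ≤ Uᶜ.ncard := by exact_mod_cast hle
      linarith
    rw [edgesBetween_bipartiteGraphOf r hUW]
    have hp := ncard_sum_eq U
    set x : V → ℝ := fun a => if Sum.inl a ∈ U then 1 else 0 with hx
    set y : V → ℝ := fun b => if Sum.inr b ∈ U then 1 else 0 with hy
    have e0 := sum_ite_sub_sq r hd hd' x y
    have hxs : ∑ a, x a ^ 2 = ∑ a, x a :=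
      Finset.sum_congr rfl fun a _ => by simp only [hx]; split_ifs <;> norm_num
    have hys : ∑ a, y a ^ 2 = ∑ a, y a :=
      Finset.sum_congr rfl fun a _ => by simp only [hy]; split_ifs <;> norm_num
    have hconst : ∀ c : ℝ, ∑ _a : V, c = N * c := fun c => by
      rw [Finset.sum_const, Finset.card_univ, nsmul_eq_mul]
    set s := ∑ a, x a with hs
    set t := ∑ b, y b with ht
    have hf : ∑ a, (x a - s / N) = 0 := by
      rw [Finset.sum_sub_distrib, hconst, mul_div_cancel₀ _ hN.ne']; simp [hs]
    have hg : ∑ a, (y a - t / N) = 0 := by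
      rw [Finset.sum_sub_distrib, hconst, mul_div_cancel₀ _ hN.ne']; simp [ht]
    have hvar : ∀ (z : V → ℝ) (w : ℝ), ∑ a, z a ^ 2 = w → ∑ a, z a = w →
        ∑ a, (z a - w / N) ^ 2 = w - w ^ 2 / N := by
      intro z w h1 h2
      have : ∀ a, (z a - w / N) ^ 2 = z a ^ 2 - 2 * (w / N) * z a + (w / N) ^ 2 := fun a => by ring
      simp only [this]
      rw [Finset.sum_add_distrib, Finset.sum_sub_distrib, ← Finset.mul_sum, h1, h2, hconst]
      field_simp; ring
    have e1 := sum_ite_mul_add_const r hd hd' _ _ hf hg (s / N) (t / N)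
    have e2 := hspec _ _ hf hg
    rw [hvar x s hxs rfl, hvar y t hys rfl] at e2
    simp only [add_sub_cancel] at e1
    have e0' : ∑ a, ∑ b, (if r a b then
        ((if Sum.inl a ∈ U then 1 else 0) - (if Sum.inr b ∈ U then 1 else 0) : ℝ) ^ 2 else 0)
        = d * (s + t) - 2 * ∑ a, ∑ b, (if r a b then x a * y b else 0) := by
      rw [← hxs, ← hys, ← e0]
    refine le_trans ?_ (le_of_eq (Eq.trans e0'.symm ?_))
    · rw [e1, hp]
      rw [hp] at hle'
      have hst : 0 ≤ s + t := by rw [← hp]; positivity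
      have e3 : d * N * (s / N * (t / N)) = d * (s * t) / N := by field_simp
      rw [e3]
      have e4 : (d - lam) / 2 * (s + t) ≤ d * (s + t) - 2 * (d * (s * t) / N) -
          lam * (s - s ^ 2 / N + (t - t ^ 2 / N)) := by
        -- The slack in the inequality is a sum of two nonnegative terms; the first one needs `|U| =
        -- s + t ≤ N`.
        have e5 : d * (s + t) - 2 * (d * (s * t) / N) - lam * (s - s ^ 2 / N + (t - t ^ 2 / N))
            - (d - lam) / 2 * (s + t) =
            ((d - lam) * (s + t) * (N - (s + t)) + (d + lam) * (s - t) ^ 2) / (2 * N) := by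
          field_simp; ring
        have e6 : 0 ≤ ((d - lam) * (s + t) * (N - (s + t)) + (d + lam) * (s - t) ^ 2) / (2 * N) := by
          have := sub_nonneg.2 hlam'
          have := sub_nonneg.2 hle'
          have : 0 ≤ d + lam := by linarith
          positivity
        linarith
      linarith
    · refine Finset.sum_congr rfl fun a _ => Finset.sum_congr rfl fun b _ => ?_
      congr
  obtain ⟨⟨U, W, hU, hW, hUW, heq⟩, -⟩ := (bipartiteGraphOf r).isLeast_iso
  rw [heq]
  have hmin : 0 < min U.ncard W.ncard :=
    lt_min ((Set.ncard_pos).2 hU) ((Set.ncard_pos).2 hW)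
  rw [le_div_iff₀ (by exact_mod_cast hmin)]
  rcases le_total U.ncard W.ncard with h | h
  · rw [min_eq_left h]; exact main U W hUW h
  · rw [min_eq_right h, edgesBetween_comm]; exact main W U hUW.symm h

/-- A pair of balanced sign functions bounds the isoperimetric constant from above. -/
theorem iso_bipartiteGraphOf_le [Nonempty V] {lam : ℝ}
    (hd : ∀ a, ∑ b, (if r a b then 1 else 0 : ℝ) = d)
    (hd' : ∀ b, ∑ a, (if r a b then 1 else 0 : ℝ) = d) (f g : V → ℝ)
    (hf : ∀ a, f a = 1 ∨ f a = -1) (hg : ∀ a, g a = 1 ∨ g a = -1)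
    (hf0 : ∑ a, f a = 0) (hg0 : ∑ a, g a = 0)
    (hfg : |∑ a, ∑ b, (if r a b then f a * g b else 0)| = lam * Fintype.card V) :
    (bipartiteGraphOf r).iso ≤ (d - lam) / 2 := by
  classical
  -- Replacing `g` by `-g` flips the sign of the form and keeps `g` balanced.
  wlog hpos : ∑ a, ∑ b, (if r a b then f a * g b else 0) = lam * Fintype.card V generalizing g
  · have e : ∑ a, ∑ b, (if r a b then f a * (-g) b else 0) =
        -∑ a, ∑ b, (if r a b then f a * g b else 0) := by
      rw [← Finset.sum_neg_distrib]
      refine Finset.sum_congr rfl fun a _ => ?_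
      rw [← Finset.sum_neg_distrib]
      refine Finset.sum_congr rfl fun b _ => ?_
      split_ifs <;> simp
    refine this (-g) (fun a => ?_) (by simp [hg0]) (by rw [e, abs_neg, hfg]) ?_
    · rcases hg a with h | h <;> simp [h]
    · rw [e]
      rcases abs_choice (∑ a, ∑ b, (if r a b then f a * g b else 0)) with h | h
      · exact absurd (h.symm.trans hfg) hpos
      · rw [← h, hfg]
  have hN : (0 : ℝ) < Fintype.card V := by exact_mod_cast Fintype.card_pos
  set N : ℝ := ((Fintype.card V : ℕ) : ℝ) with hNdef
  -- The cut separates the signs; as `f` and `g` are balanced, both sides have `N` vertices.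
  let U : Set (V ⊕ V) := {v | Sum.elim f g v = 1}
  have hx : ∀ a, (if Sum.inl a ∈ U then 1 else 0 : ℝ) = 1 / 2 + f a / 2 := fun a => by
    rcases hf a with h | h <;> simp [U, h] <;> norm_num
  have hy : ∀ a, (if Sum.inr a ∈ U then 1 else 0 : ℝ) = 1 / 2 + g a / 2 := fun a => by
    rcases hg a with h | h <;> simp [U, h] <;> norm_num
  have hconst : ∀ c : ℝ, ∑ _a : V, c = N * c := fun c => by
    rw [Finset.sum_const, Finset.card_univ, nsmul_eq_mul]
  have hcard : (U.ncard : ℝ) = N := by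
    rw [ncard_sum_eq]
    simp only [hx, hy, Finset.sum_add_distrib, ← Finset.sum_div, hf0, hg0, hconst]
    ring
  have hcard' : (Uᶜ.ncard : ℝ) = N := by
    have := ncard_compl_sum U
    linarith
  have hne : U.Nonempty := by
    rw [← Set.ncard_pos]; rw [← hcard] at hN; exact_mod_cast hN
  have hne' : Uᶜ.Nonempty := by
    rw [← Set.ncard_pos]; rw [← hcard'] at hN; exact_mod_cast hN
  refine ((bipartiteGraphOf r).isLeast_iso.2 ⟨U, Uᶜ, hne, hne', isCompl_compl, rfl⟩).trans ?_
  have e0 := sum_ite_sub_sq r hd hd' (fun a => 1 / 2 + f a / 2) (fun a => 1 / 2 + g a / 2)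
  have e1 := sum_ite_mul_add_const r hd hd' (fun a => f a / 2) (fun a => g a / 2)
    (by rw [← Finset.sum_div, hf0, zero_div]) (by rw [← Finset.sum_div, hg0, zero_div])
    (1 / 2) (1 / 2)
  have e2 : ∑ a, ∑ b, (if r a b then f a / 2 * (g b / 2) else 0) = lam * N / 4 := by
    rw [← hpos, Finset.sum_div]
    refine Finset.sum_congr rfl fun a _ => ?_
    rw [Finset.sum_div]
    refine Finset.sum_congr rfl fun b _ => ?_
    split_ifs <;> ring
  have hsq : ∀ z : V → ℝ, (∀ a, z a = 1 ∨ z a = -1) → ∑ a, z a = 0 →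
      ∑ a, (1 / 2 + z a / 2) ^ 2 = N / 2 := by
    intro z hz hz0
    have : ∀ a, (1 / 2 + z a / 2) ^ 2 = 1 / 2 + z a / 2 := fun a => by
      rcases hz a with h | h <;> rw [h] <;> norm_num
    simp only [this, Finset.sum_add_distrib, ← Finset.sum_div, hz0, hconst]
    ring
  have hE : ((bipartiteGraphOf r).edgesBetween U Uᶜ : ℝ) = (d - lam) / 2 * N := by
    rw [edgesBetween_bipartiteGraphOf r isCompl_compl]
    simp only [hx, hy]
    refine Eq.trans ?_ (e0.trans ?_)
    · refine Finset.sum_congr rfl fun a _ => Finset.sum_congr rfl fun b _ => ?_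
      congr
    · rw [e1, e2, hsq f hf hf0, hsq g hg hg0]
      ring
  have hmin : ((min U.ncard Uᶜ.ncard : ℕ) : ℝ) = N := by
    rw [Nat.cast_min, hcard, hcard', min_self]
  rw [hE, hmin, mul_div_cancel_right₀ _ hN.ne']

/-- If `A Aᵀ` is the sum of a multiple of `J - T`, with `T` positive semidefinite, and a
nonnegative symmetric matrix with row sums at most `ρ`, then `A` is bounded by `√ρ` on functions
of mean zero. -/
theorem two_mul_sum_ite_mul_le {A : V → V → ℝ} {T : V → V → ℝ} {c lam ρ : ℝ}
    (hlam : 0 < lam) (hρ : lam ^ 2 = ρ) (hc : 0 ≤ c) (hT : ∀ a a', T a a' = T a' a)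
    (hpsd : ∀ f : V → ℝ, 0 ≤ ∑ a, ∑ a', f a * f a' * T a a')
    (hP : ∀ a a', c * (1 - T a a') ≤ ∑ b, A a b * A a' b)
    (hrow : ∀ a, ∑ a', (∑ b, A a b * A a' b - c * (1 - T a a')) ≤ ρ)
    (f g : V → ℝ) (hf : ∑ a, f a = 0) :
    2 * ∑ a, ∑ b, A a b * (f a * g b) ≤ lam * (∑ a, f a ^ 2 + ∑ b, g b ^ 2) := by
  set P : V → V → ℝ := fun a a' => ∑ b, A a b * A a' b - c * (1 - T a a') with hPdef
  have hP0 : ∀ a a', 0 ≤ P a a' := fun a a' => sub_nonneg.2 (hP a a')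
  have hPs : ∀ a a', P a a' = P a' a := fun a a' => by
    simp only [hPdef, hT a a', mul_comm]
  have e1 : ∑ b, (∑ a, A a b * f a) ^ 2 = ∑ a, ∑ a', f a * f a' * ∑ b, A a b * A a' b := by
    simp only [sq, Finset.sum_mul_sum]
    simp only [Finset.mul_sum]
    rw [Finset.sum_comm]
    refine Finset.sum_congr rfl fun a _ => ?_
    rw [Finset.sum_comm]
    refine Finset.sum_congr rfl fun a' _ => Finset.sum_congr rfl fun b _ => ?_
    ring
  have e2 : ∑ a, ∑ a', f a * f a' * ∑ b, A a b * A a' b =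
      c * (∑ a, f a) ^ 2 - c * ∑ a, ∑ a', f a * f a' * T a a' + ∑ a, ∑ a', f a * f a' * P a a' := by
    rw [sq, Finset.sum_mul_sum, Finset.mul_sum, Finset.mul_sum, ← Finset.sum_sub_distrib,
      ← Finset.sum_add_distrib]
    refine Finset.sum_congr rfl fun a _ => ?_
    rw [Finset.mul_sum, Finset.mul_sum, ← Finset.sum_sub_distrib, ← Finset.sum_add_distrib]
    refine Finset.sum_congr rfl fun a' _ => ?_
    simp only [hPdef]
    ring
  have e3 : ∑ a, ∑ a', f a * f a' * P a a' ≤ ρ * ∑ a, f a ^ 2 := by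
    -- Schur test: for a symmetric nonnegative kernel, `2xy ≤ x² + y²` bounds the form by the row
    -- sums.
    have h1 : ∀ a a', f a * f a' * P a a' ≤ f a ^ 2 / 2 * P a a' + f a' ^ 2 / 2 * P a' a := by
      intro a a'
      rw [hPs a' a, ← add_mul]
      refine mul_le_mul_of_nonneg_right ?_ (hP0 a a')
      nlinarith [sq_nonneg (f a - f a')]
    have h2 : ∑ a, ∑ a', f a ^ 2 / 2 * P a a' ≤ ρ / 2 * ∑ a, f a ^ 2 := by
      rw [Finset.mul_sum]
      refine Finset.sum_le_sum fun a _ => ?_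
      rw [← Finset.mul_sum]
      have := mul_le_mul_of_nonneg_left (hrow a) (show 0 ≤ f a ^ 2 / 2 by positivity)
      linarith
    calc ∑ a, ∑ a', f a * f a' * P a a'
        ≤ ∑ a, ∑ a', (f a ^ 2 / 2 * P a a' + f a' ^ 2 / 2 * P a' a) :=
          Finset.sum_le_sum fun a _ => Finset.sum_le_sum fun a' _ => h1 a a'
      _ = ∑ a, ∑ a', f a ^ 2 / 2 * P a a' + ∑ a, ∑ a', f a ^ 2 / 2 * P a a' := by
          simp only [Finset.sum_add_distrib]
          congr 1
          rw [Finset.sum_comm]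
      _ ≤ _ := by linarith
  have e4 : ∑ b, (∑ a, A a b * f a) ^ 2 ≤ lam ^ 2 * ∑ a, f a ^ 2 := by
    rw [e1, e2, hf, hρ]
    -- The all-ones part vanishes because `f` has mean zero, and the `T` part has a favourable sign.
    have := mul_nonneg hc (hpsd f)
    linarith
  have e5 : ∑ a, ∑ b, A a b * (f a * g b) = ∑ b, (∑ a, A a b * f a) * g b := by
    rw [Finset.sum_comm]
    refine Finset.sum_congr rfl fun b _ => ?_
    rw [Finset.sum_mul]
    exact Finset.sum_congr rfl fun a _ => by ring
  rw [e5]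
  have e6 : ∀ b, 2 * ((∑ a, A a b * f a) * g b) ≤ (∑ a, A a b * f a) ^ 2 / lam + lam * g b ^ 2 := by
    intro b
    set h := ∑ a, A a b * f a
    have : h ^ 2 / lam + lam * g b ^ 2 - 2 * (h * g b) = (h - lam * g b) ^ 2 / lam := by
      field_simp; ring
    have : 0 ≤ (h - lam * g b) ^ 2 / lam := by positivity
    linarith
  calc 2 * ∑ b, (∑ a, A a b * f a) * g b
      ≤ ∑ b, ((∑ a, A a b * f a) ^ 2 / lam + lam * g b ^ 2) := by
        rw [Finset.mul_sum]; exact Finset.sum_le_sum fun b _ => e6 b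
    _ = (∑ b, (∑ a, A a b * f a) ^ 2) / lam + lam * ∑ b, g b ^ 2 := by
        rw [Finset.sum_add_distrib, Finset.sum_div, Finset.mul_sum]
    _ ≤ lam * ∑ a, f a ^ 2 + lam * ∑ b, g b ^ 2 := by
        have : (∑ b, (∑ a, A a b * f a) ^ 2) / lam ≤ lam * ∑ a, f a ^ 2 := by
          rw [div_le_iff₀ hlam]; linarith
        linarith
    _ = _ := by ring

end Regular

/-! ### Linear equations over a finite local ring -/

open IsLocalRing

theorem natCard_fiber_mul {G H : Type*} [AddGroup G] [AddGroup H] [Finite G] (φ : G →+ H)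
    (hφ : Function.Surjective φ) (y : H) :
    Nat.card {g // φ g = y} * Nat.card H = Nat.card G := by
  obtain ⟨g₀, rfl⟩ := hφ y
  have e : {g // φ g = φ g₀} ≃ φ.ker :=
    { toFun := fun g => ⟨g - g₀, by simp [AddMonoidHom.mem_ker, g.2]⟩
      invFun := fun x => ⟨x + g₀, by
        rw [map_add, AddMonoidHom.mem_ker.1 x.2, zero_add]⟩
      left_inv := fun g => by simp
      right_inv := fun x => by simp }
  rw [Nat.card_congr e, ← Nat.card_congr (QuotientAddGroup.quotientKerEquivOfSurjective φ hφ).toEquiv,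
    mul_comm, ← AddSubgroup.card_eq_card_quotient_mul_card_addSubgroup]

theorem sum_ite_one_eq_natCard {α : Type*} [Fintype α] (p : α → Prop) [DecidablePred p] :
    ∑ b, (if p b then 1 else 0 : ℝ) = Nat.card {b // p b} := by
  rw [Finset.sum_boole, Nat.card_eq_fintype_card, Fintype.card_subtype]

section Local

variable {R : Type*} [CommRing R] [IsLocalRing R] {n : ℕ}

/-- The reduction of a vector over a local ring modulo the maximal ideal. -/
noncomputable def redVec : (Fin n → R) →+ (Fin n → ResidueField R) :=
  (residue R).toAddMonoidHom.compLeft (Fin n)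

theorem redVec_apply (a : Fin n → R) (i : Fin n) : redVec a i = residue R (a i) := rfl

theorem redVec_surjective : Function.Surjective (redVec : (Fin n → R) →+ _) :=
  residue_surjective.comp_left

theorem redVec_smul (t : R) (a : Fin n → R) : redVec (t • a) = residue R t • redVec a := by
  ext i; simp [redVec_apply]

theorem residue_dotProduct (a b : Fin n → R) :
    residue R (a ⬝ᵥ b) = redVec a ⬝ᵥ redVec b := by
  simp [dotProduct, redVec_apply]

theorem redVec_eq_zero_iff {a : Fin n → R} : redVec a = 0 ↔ ∀ i, a i ∈ maximalIdeal R := by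
  simp [funext_iff, redVec_apply, residue_eq_zero_iff]

theorem exists_isUnit_of_redVec_ne_zero {a : Fin n → R} (ha : redVec a ≠ 0) :
    ∃ i, IsUnit (a i) := by
  by_contra! h
  exact ha (redVec_eq_zero_iff.2 h)

theorem mem_unimodularTuples_iff {a : Fin n → R} :
    a ∈ unimodularTuples R n ↔ redVec a ≠ 0 := by
  rw [Ne, redVec_eq_zero_iff]
  change Ideal.span (Set.range a) = ⊤ ↔ _
  constructor
  · intro h h'
    have : Ideal.span (Set.range a) ≤ maximalIdeal R := by
      rw [Ideal.span_le]; rintro _ ⟨i, rfl⟩; exact h' i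
    rw [h, top_le_iff] at this
    exact (maximalIdeal.isMaximal R).ne_top this
  · intro h
    by_contra hne
    exact h fun i => le_maximalIdeal hne (Ideal.subset_span ⟨i, rfl⟩)

theorem redVec_coe_ne_zero (a : unimodularTuples R n) : redVec (a : Fin n → R) ≠ 0 :=
  mem_unimodularTuples_iff.1 a.2

theorem natCard_eq_mul_maximalIdeal (R : Type*) [CommRing R] [IsLocalRing R] :
    Nat.card R = Nat.card (ResidueField R) * Nat.card (maximalIdeal R) := by
  rw [mul_comm]
  exact Submodule.card_eq_card_quotient_mul_card (maximalIdeal R)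

theorem sum_unimodularTuples [Fintype R] [Fintype (unimodularTuples R n)]
    (h : (Fin n → R) → ℝ) (h0 : ∀ a, redVec a = 0 → h a = 0) :
    ∑ a : unimodularTuples R n, h a = ∑ a, h a := by
  classical
  rw [← Finset.sum_filter_add_sum_filter_not Finset.univ (fun a => a ∈ unimodularTuples R n),
    Finset.sum_eq_zero (s := Finset.filter (fun a => a ∉ unimodularTuples R n) _), add_zero]
  · exact (Finset.sum_subtype (p := fun a => a ∈ unimodularTuples R n) _ (by simp) h).symm
  · intro a ha
    refine h0 a ?_
    have := (Finset.mem_filter.1 ha).2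
    rwa [mem_unimodularTuples_iff, not_not] at this

variable [Finite R]

instance finite_residueField : Finite (ResidueField R) := Finite.of_surjective _ residue_surjective

theorem natCard_residueField_pos (R : Type*) [CommRing R] [IsLocalRing R] [Finite R] :
    0 < Nat.card (ResidueField R) := Nat.card_pos

/-- A unit entry of `a` makes `b ↦ a ⬝ᵥ b` surjective from `Iⁿ` to `I`, and its fibres are
equinumerous. With `I = R` this counts all solutions; with `I` the maximal ideal it counts the
non-unimodular ones, and also the lifts of a fixed residue solution. -/
theorem natCard_dotProduct_eq (I : Ideal R) {a : Fin n → R} (ha : redVec a ≠ 0) {x : R}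
    (hx : x ∈ I) :
    Nat.card {b : Fin n → R // (∀ i, b i ∈ I) ∧ a ⬝ᵥ b = x} = Nat.card I ^ (n - 1) := by
  obtain ⟨i, hi⟩ := exists_isUnit_of_redVec_ne_zero ha
  obtain ⟨u, hu⟩ := hi
  let φ : (Fin n → I) →+ I :=
    { toFun := fun b => ∑ i, a i • b i
      map_zero' := by simp
      map_add' := by intro b c; simp [smul_add, Finset.sum_add_distrib] }
  have hφ : Function.Surjective φ := fun y => by
    refine ⟨Pi.single i ((↑u⁻¹ : R) • y), ?_⟩
    change ∑ j, a j • (Pi.single i ((↑u⁻¹ : R) • y) : Fin n → I) j = y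
    rw [Finset.sum_eq_single i (fun j _ hj => by simp [hj]) (by simp), Pi.single_eq_same, ← hu,
      smul_smul]
    simp
  have hφv : ∀ b, ((φ b : I) : R) = a ⬝ᵥ fun i => (b i : R) := fun b => by
    change ((∑ i, a i • b i : I) : R) = _
    simp [dotProduct]
  have h := natCard_fiber_mul φ hφ ⟨x, hx⟩
  have e : {b : Fin n → I // φ b = ⟨x, hx⟩} ≃ {b : Fin n → R // (∀ i, b i ∈ I) ∧ a ⬝ᵥ b = x} :=
    { toFun := fun b => ⟨fun i => b.1 i, fun i => (b.1 i).2, by rw [← hφv, b.2]⟩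
      invFun := fun b => ⟨fun i => ⟨b.1 i, b.2.1 i⟩, Subtype.ext (by rw [hφv]; exact b.2.2)⟩
      left_inv := fun b => rfl
      right_inv := fun b => rfl }
  have hn : n = (n - 1) + 1 := by have := i.isLt; omega
  rw [Nat.card_congr e, Nat.card_fun, Nat.card_fin, show Nat.card I ^ n = Nat.card I ^ (n - 1) *
    Nat.card I by conv_lhs => rw [hn, pow_succ]] at h
  exact Nat.eq_of_mul_eq_mul_right Nat.card_pos h

/-- Row reduction: subtracting a multiple of `a` clears the entry of `c` where `a` has a unit, and
the hypothesis leaves a unit at another index. The two equations are then triangular, hence solvable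
for every right-hand side. -/
theorem natCard_dotProduct_eq_and_eq (I : Ideal R) {a c : Fin n → R} (ha : redVec a ≠ 0)
    (hc : ∀ t : ResidueField R, redVec c ≠ t • redVec a) {x y : R} (hx : x ∈ I) (hy : y ∈ I) :
    Nat.card {b : Fin n → R // (∀ i, b i ∈ I) ∧ a ⬝ᵥ b = x ∧ c ⬝ᵥ b = y} =
      Nat.card I ^ (n - 2) := by
  obtain ⟨i, u, hu⟩ := exists_isUnit_of_redVec_ne_zero ha
  set t : R := c i * (↑u⁻¹ : R) with ht
  have hc' : redVec (c - t • a) ≠ 0 := by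
    rw [map_sub, redVec_smul, sub_ne_zero]; exact hc _
  obtain ⟨j, v, hv⟩ := exists_isUnit_of_redVec_ne_zero hc'
  have hti : c i = t * a i := by rw [ht, ← hu, mul_assoc]; simp
  have hij : i ≠ j := by
    rintro rfl
    have h0 : (c - t • a) i = 0 := by simp [hti]
    rw [h0] at hv
    exact v.ne_zero hv
  have hvj : (v : R) = c j - t * a j := by simpa using hv
  let φ : (Fin n → I) →+ I × I :=
    { toFun := fun b => (∑ i, a i • b i, ∑ i, c i • b i)
      map_zero' := by simp
      map_add' := by intro b c; simp [smul_add, Finset.sum_add_distrib] }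
  have hφ : Function.Surjective φ := fun ⟨y, z⟩ => by
    obtain ⟨w, hvw⟩ : ∃ w : I, (v : R) • w = z - t • y :=
      ⟨(↑v⁻¹ : R) • (z - t • y), by rw [smul_smul]; simp⟩
    refine ⟨Pi.single j w + Pi.single i ((↑u⁻¹ : R) • (y - a j • w)), ?_⟩
    have hsum : ∀ (d : Fin n → R) (w w' : I),
        ∑ k, d k • (Pi.single j w + Pi.single i w' : Fin n → I) k = d j • w + d i • w' := by
      intro d w w'
      simp only [Pi.add_apply, smul_add, Finset.sum_add_distrib]
      rw [Finset.sum_eq_single j (fun k _ hk => by simp [hk]) (by simp),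
        Finset.sum_eq_single i (fun k _ hk => by simp [hk]) (by simp)]
      simp
    have h1 : a j • w + a i • ((↑u⁻¹ : R) • (y - a j • w)) = y := by
      rw [← hu, smul_smul]; simp
    refine Prod.ext ?_ ?_
    · exact (hsum a _ _).trans h1
    · refine (hsum c _ _).trans ?_
      have h2 : c j • w = (v : R) • w + t • (a j • w) := by
        rw [hvj, smul_smul, ← add_smul]; congr 1; ring
      have h3 : c i • ((↑u⁻¹ : R) • (y - a j • w)) =
          t • (a i • ((↑u⁻¹ : R) • (y - a j • w))) := by rw [hti, mul_smul]
      rw [h2, h3, hvw, add_assoc, ← smul_add, h1]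
      simp
  have hφv : ∀ b, ((φ b).1 : R) = a ⬝ᵥ (fun i => (b i : R)) ∧
      ((φ b).2 : R) = c ⬝ᵥ (fun i => (b i : R)) := fun b => by
    change ((∑ i, a i • b i : I) : R) = _ ∧ ((∑ i, c i • b i : I) : R) = _
    simp [dotProduct]
  have h := natCard_fiber_mul φ hφ (⟨x, hx⟩, ⟨y, hy⟩)
  have e : {b : Fin n → I // φ b = (⟨x, hx⟩, ⟨y, hy⟩)} ≃
      {b : Fin n → R // (∀ i, b i ∈ I) ∧ a ⬝ᵥ b = x ∧ c ⬝ᵥ b = y} :=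
    { toFun := fun b => ⟨fun i => b.1 i, fun i => (b.1 i).2,
        by rw [← (hφv _).1, b.2], by rw [← (hφv _).2, b.2]⟩
      invFun := fun b => ⟨fun i => ⟨b.1 i, b.2.1 i⟩, Prod.ext
        (Subtype.ext (by rw [(hφv _).1]; exact b.2.2.1))
        (Subtype.ext (by rw [(hφv _).2]; exact b.2.2.2))⟩
      left_inv := fun b => rfl
      right_inv := fun b => rfl }
  have hn : n = (n - 2) + 1 + 1 := by
    have := i.isLt; have := j.isLt; have := Fin.val_ne_of_ne hij; omega
  rw [Nat.card_congr e, Nat.card_fun, Nat.card_fin, Nat.card_prod, show Nat.card I ^ n =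
    Nat.card I ^ (n - 2) * (Nat.card I * Nat.card I) by
      conv_lhs => rw [hn, pow_succ, pow_succ, mul_assoc]] at h
  exact Nat.eq_of_mul_eq_mul_right (Nat.mul_pos Nat.card_pos Nat.card_pos) h

theorem natCard_top_ideal (R : Type*) [CommRing R] : Nat.card (⊤ : Ideal R) = Nat.card R :=
  Nat.card_congr Submodule.topEquiv.toEquiv

theorem natCard_dotProduct_eq_top {a : Fin n → R} (ha : redVec a ≠ 0) (x : R) :
    Nat.card {b : Fin n → R // a ⬝ᵥ b = x} = Nat.card R ^ (n - 1) := by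
  rw [← natCard_top_ideal R, ← natCard_dotProduct_eq ⊤ ha (Submodule.mem_top (x := x))]
  exact Nat.card_congr (Equiv.subtypeEquivRight fun b => by simp)

theorem natCard_dotProduct_eq_and_eq_top {a c : Fin n → R} (ha : redVec a ≠ 0)
    (hc : ∀ t : ResidueField R, redVec c ≠ t • redVec a) (x y : R) :
    Nat.card {b : Fin n → R // a ⬝ᵥ b = x ∧ c ⬝ᵥ b = y} = Nat.card R ^ (n - 2) := by
  rw [← natCard_top_ideal R,
    ← natCard_dotProduct_eq_and_eq ⊤ ha hc (Submodule.mem_top (x := x))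
      (Submodule.mem_top (x := y))]
  exact Nat.card_congr (Equiv.subtypeEquivRight fun b => by simp)

theorem natCard_redVec_fiber (v : Fin n → ResidueField R) :
    Nat.card {a : Fin n → R // redVec a = v} = Nat.card (maximalIdeal R) ^ n := by
  have h := natCard_fiber_mul (redVec : (Fin n → R) →+ _) redVec_surjective v
  rw [Nat.card_fun, Nat.card_fun, Nat.card_fin, natCard_eq_mul_maximalIdeal R, mul_pow,
    mul_comm] at h
  exact Nat.eq_of_mul_eq_mul_left (pow_pos (natCard_residueField_pos R) n) h

theorem sum_comp_redVec [Fintype R] [Fintype (ResidueField R)] (h : (Fin n → ResidueField R) → ℝ) :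
    ∑ a : Fin n → R, h (redVec a) = (Nat.card (maximalIdeal R) : ℝ) ^ n * ∑ v, h v := by
  classical
  rw [← Finset.sum_fiberwise (s := Finset.univ) (g := fun a : Fin n → R => redVec a), Finset.mul_sum]
  refine Finset.sum_congr rfl fun v _ => ?_
  rw [Finset.sum_congr rfl (g := fun _ => h v) (fun a ha => by rw [(Finset.mem_filter.1 ha).2]),
    Finset.sum_const, nsmul_eq_mul, ← Fintype.card_subtype, ← Nat.card_eq_fintype_card,
    natCard_redVec_fiber, Nat.cast_pow]

theorem sum_unimodularTuples_comp_redVec [Fintype R] [Fintype (unimodularTuples R n)]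
    [Fintype (ResidueField R)] (h : (Fin n → ResidueField R) → ℝ) (h0 : h 0 = 0) :
    ∑ a : unimodularTuples R n, h (redVec (a : Fin n → R)) =
      (Nat.card (maximalIdeal R) : ℝ) ^ n * ∑ v, h v := by
  rw [← sum_comp_redVec]
  exact sum_unimodularTuples (fun a => h (redVec a)) fun a ha => by rw [ha, h0]

theorem card_unimodularTuples [Fintype R] [Fintype (unimodularTuples R n)] :
    (Fintype.card (unimodularTuples R n) : ℝ) =
      (Nat.card (maximalIdeal R) : ℝ) ^ n * ((Nat.card (ResidueField R) : ℝ) ^ n - 1) := by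
  classical
  have := Fintype.ofFinite (ResidueField R)
  have h := sum_unimodularTuples_comp_redVec (R := R) (n := n)
    (fun v => if v = 0 then 0 else 1) (by simp)
  rw [Finset.sum_congr rfl (g := fun _ => (1 : ℝ))
    (fun a _ => if_neg (redVec_coe_ne_zero a))] at h
  have e : ∑ v : Fin n → ResidueField R, (if v = 0 then 0 else 1 : ℝ) =
      (Nat.card (ResidueField R) : ℝ) ^ n - 1 := by
    have : ∀ v : Fin n → ResidueField R, (if v = 0 then 0 else 1 : ℝ) =
        1 - if v = 0 then 1 else 0 := fun v => by split_ifs <;> simp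
    simp only [this, Finset.sum_sub_distrib]
    simp [Nat.card_eq_fintype_card]
  rw [e] at h
  simpa using h

end Local

/-- A finite local ring with principal maximal ideal `(π)` has `q ^ ℓ` elements and its maximal
ideal has `q ^ (ℓ - 1)`, where `ℓ` is the nilpotency index of `π`. -/
theorem natCard_maximalIdeal {R : Type*} [CommRing R] [Finite R] [IsLocalRing R] {π : R}
    (hπ : maximalIdeal R = Ideal.span {π}) {ℓ : ℕ}
    (hℓ : IsLeast {k : ℕ | 0 < k ∧ π ^ k = 0} ℓ) :
    Nat.card (maximalIdeal R) = Nat.card (ResidueField R) ^ (ℓ - 1) := by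
  have hne : ∀ k < ℓ, π ^ k ≠ 0 := fun k hk h0 => by
    rcases Nat.eq_zero_or_pos k with rfl | hpos
    · simp at h0
    · exact absurd (hℓ.2 ⟨hpos, h0⟩) (by omega)
  have hmem : ∀ x ∈ maximalIdeal R, ∃ y, y * π = x := fun x hx => by
    rw [hπ] at hx; exact Ideal.mem_span_singleton'.1 hx
  have hmem' : ∀ y, y * π ∈ maximalIdeal R := fun y => by
    rw [hπ]; exact Ideal.mul_mem_left _ _ (Ideal.mem_span_singleton_self _)
  -- Multiplication by `π ^ k` maps `R` onto `(π ^ k)` and the maximal ideal onto `(π ^ (k + 1))`.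
  -- The kernels agree, since a unit in the kernel would give `π ^ k = 0`; so the two images have
  -- the same ratio of sizes as `R` and its maximal ideal.
  have hstep : ∀ k < ℓ, Nat.card (Ideal.span {π ^ k} : Ideal R) =
      Nat.card (ResidueField R) * Nat.card (Ideal.span {π ^ (k + 1)} : Ideal R) := by
    intro k hk
    let φ : R →ₗ[R] (Ideal.span {π ^ k} : Ideal R) :=
      LinearMap.toSpanSingleton R _ ⟨π ^ k, Ideal.mem_span_singleton_self _⟩
    have hφ : ∀ x, ((φ x : (Ideal.span {π ^ k} : Ideal R)) : R) = x * π ^ k := fun x => rfl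
    have hsurj : Function.Surjective φ := by
      rintro ⟨y, hy⟩
      obtain ⟨x, hx⟩ := Ideal.mem_span_singleton'.1 hy
      exact ⟨x, Subtype.ext hx⟩
    have hker : (maximalIdeal R) = maximalIdeal R ⊔ LinearMap.ker φ := by
      refine (sup_eq_left.2 ?_).symm
      refine le_maximalIdeal fun htop => hne k hk ?_
      have h1 : (1 : R) ∈ LinearMap.ker φ := htop ▸ Submodule.mem_top
      simpa [hφ] using congrArg Subtype.val (LinearMap.mem_ker.1 h1)
    have h1 := natCard_fiber_mul φ.toAddMonoidHom hsurj 0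
    let ψ : maximalIdeal R →+ (Ideal.span {π ^ (k + 1)} : Ideal R) :=
      { toFun := fun x => ⟨x * π ^ k, by
          obtain ⟨y, hy⟩ := hmem x x.2
          rw [← hy, mul_assoc, ← pow_succ']
          exact Ideal.mul_mem_left _ _ (Ideal.mem_span_singleton_self _)⟩
        map_zero' := by simp
        map_add' := fun x y => Subtype.ext (by simp [add_mul]) }
    have hψ : Function.Surjective ψ := by
      rintro ⟨y, hy⟩
      obtain ⟨x, hx⟩ := Ideal.mem_span_singleton'.1 hy
      refine ⟨⟨x * π, hmem' x⟩,
        Subtype.ext ?_⟩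
      change x * π * π ^ k = y
      rw [← hx, pow_succ']; ring
    have h2 := natCard_fiber_mul ψ hψ 0
    have e : {x // φ.toAddMonoidHom x = 0} ≃ {x // ψ x = 0} :=
      { toFun := fun x => ⟨⟨x.1, by
          rw [hker]; exact Submodule.mem_sup_right (LinearMap.mem_ker.2 x.2)⟩,
          Subtype.ext (show x.1 * π ^ k = 0 from congrArg Subtype.val x.2)⟩
        invFun := fun x => ⟨x.1.1, Subtype.ext (show x.1.1 * π ^ k = 0 from congrArg Subtype.val x.2)⟩
        left_inv := fun x => rfl
        right_inv := fun x => rfl }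
    rw [Nat.card_congr e, natCard_eq_mul_maximalIdeal R, ← h2] at h1
    have hpos : 0 < Nat.card {x // ψ x = 0} := by
      have : Nonempty {x // ψ x = 0} := ⟨⟨0, map_zero ψ⟩⟩
      exact Nat.card_pos
    refine Nat.eq_of_mul_eq_mul_left hpos (h1.trans ?_)
    ring
  have hind : ∀ j ≤ ℓ, Nat.card (Ideal.span {π ^ (ℓ - j)} : Ideal R) =
      Nat.card (ResidueField R) ^ j := by
    intro j
    induction j with
    | zero =>
      intro _
      rw [Nat.sub_zero, hℓ.1.2]
      simp
    | succ j ih =>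
      intro hj
      rw [hstep _ (by omega), show ℓ - (j + 1) + 1 = ℓ - j by omega, ih (by omega), pow_succ']
  have h := hind (ℓ - 1) (by omega)
  have hpos := hℓ.1.1
  rwa [show ℓ - (ℓ - 1) = 1 by omega, pow_one, ← hπ] at h

/-! ### Common neighbours and norm bounds on unimodular tuples -/

-- The form is a sum of squares, one for each fibre of `φ`. This supplies the positive semidefinite
-- `T` for the relation of spanning the same residue line.
open scoped Classical in
theorem sum_mul_ite_eq_nonneg {V W : Type*} [Fintype V] (φ : V → W) (f : V → ℝ) :
    0 ≤ ∑ a, ∑ a', f a * f a' * (if φ a = φ a' then 1 else 0 : ℝ) := by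
  have e : ∑ a, ∑ a', f a * f a' * (if φ a = φ a' then 1 else 0 : ℝ) =
      ∑ c ∈ Finset.univ.image φ, (∑ a, f a * (if φ a = c then 1 else 0 : ℝ)) ^ 2 := by
    simp only [sq, Finset.sum_mul_sum]
    symm
    rw [Finset.sum_comm]
    refine Finset.sum_congr rfl fun a _ => ?_
    rw [Finset.sum_comm]
    refine Finset.sum_congr rfl fun a' _ => ?_
    rw [Finset.sum_eq_single (φ a)]
    · by_cases h : φ a = φ a'
      · simp [h]
      · simp [h, Ne.symm h]
    · intro c _ hc
      simp [hc.symm]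
    · simp
  rw [e]
  positivity

section Local

variable {R : Type*} [CommRing R] [IsLocalRing R] {n : ℕ}

theorem exists_redVec_eq_smul_iff (a a' : unimodularTuples R n) :
    (∃ t : ResidueField R, redVec (a' : Fin n → R) = t • redVec (a : Fin n → R)) ↔
      Submodule.span (ResidueField R) {redVec (a : Fin n → R)} =
        Submodule.span (ResidueField R) {redVec (a' : Fin n → R)} := by
  rw [Submodule.span_singleton_eq_span_singleton]
  constructor
  · rintro ⟨t, ht⟩
    have ht0 : t ≠ 0 := by
      rintro rfl
      exact redVec_coe_ne_zero a' (by rw [ht, zero_smul])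
    exact ⟨Units.mk0 t ht0, ht.symm⟩
  · rintro ⟨z, hz⟩
    exact ⟨z, hz.symm⟩

/-- A vector outside the line of `a` generating, together with `a`, any given vector. -/
theorem exists_eq_smul_add_smul [IsPrincipalIdealRing R] (hn : 2 ≤ n) {a : Fin n → R}
    (ha : redVec a ≠ 0) (a' : Fin n → R) :
    ∃ c : Fin n → R, (∀ t : ResidueField R, redVec c ≠ t • redVec a) ∧
      ∃ s x : R, a' = s • a + x • c := by
  classical
  obtain ⟨i, u, hu⟩ := exists_isUnit_of_redVec_ne_zero ha
  have key : ∀ c : Fin n → R, c i = 0 → redVec c ≠ 0 →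
      ∀ t : ResidueField R, redVec c ≠ t • redVec a := by
    intro c hci hc t h
    have h1 := congrFun h i
    rw [redVec_apply, hci, map_zero, Pi.smul_apply, redVec_apply, smul_eq_mul] at h1
    have h2 : residue R (a i) ≠ 0 := by
      rw [← hu]; exact (u.isUnit.map (residue R)).ne_zero
    have h3 : t = 0 := by
      rcases mul_eq_zero.1 h1.symm with h | h
      · exact h
      · exact absurd h h2
    exact hc (by rw [h, h3, zero_smul])
  -- The multiple of `a` that agrees with `a'` at the index `i` where `a` has a unit entry.
  set s : R := a' i * (↑u⁻¹ : R) with hs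
  set d : Fin n → R := a' - s • a with hd
  have hdi : d i = 0 := by simp [hd, hs, ← hu, mul_assoc]
  -- Factoring a generator of the ideal of entries out of `d` leaves the candidate for `c`.
  obtain ⟨x, hx⟩ := (IsPrincipalIdealRing.principal (Ideal.span (Set.range d))).principal
  have hdx : ∀ j, ∃ r, r * x = d j := fun j => by
    have : d j ∈ Ideal.span (Set.range d) := Ideal.subset_span ⟨j, rfl⟩
    rw [hx] at this
    exact Ideal.mem_span_singleton'.1 this
  choose c hc using hdx
  by_cases hx0 : x = 0
  · have hd0 : d = 0 := by
      ext j; rw [← hc j, hx0, mul_zero]; rfl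
    obtain ⟨j, hj⟩ : ∃ j : Fin n, j ≠ i := by
      have : Nontrivial (Fin n) := Fin.nontrivial_iff_two_le.2 hn
      exact exists_ne i
    refine ⟨Pi.single j 1, key _ (by simp [hj.symm]) (fun h => ?_), s, 0, ?_⟩
    · have := congrFun h j
      simp [redVec_apply] at this
    · rw [zero_smul, add_zero]
      exact sub_eq_zero.1 hd0
  -- Since `d i = 0`, the `i`-th entry of `c` may be reset to zero, which keeps `c` off the line of
  -- `a` as soon as its reduction is nonzero.
  · have hcd : x • Function.update c i 0 = d := by
      ext j
      by_cases hj : j = i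
      · subst hj; simp [hdi]
      · simp [hj, ← hc j, mul_comm]
    refine ⟨Function.update c i 0, key _ (by simp) (fun h => hx0 ?_), s, x, ?_⟩
    -- If all entries of `c` were in the maximal ideal, then `x = w x` with `w` in that ideal, so `x
    -- = 0`.
    · have hxm : x ∈ Ideal.span (Set.range d) := by
        rw [hx]; exact Submodule.mem_span_singleton_self x
      obtain ⟨r, hr⟩ := (Ideal.mem_span_range_iff_exists_fun).1 hxm
      set w := ∑ j, r j * Function.update c i 0 j with hw
      have hwm : w ∈ maximalIdeal R :=
        Ideal.sum_mem _ fun j _ => Ideal.mul_mem_left _ _ (redVec_eq_zero_iff.1 h j)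
      have hwx : (1 - w) * x = 0 := by
        rw [sub_mul, one_mul, sub_eq_zero]
        conv_lhs => rw [← hr, ← hcd]
        rw [hw, Finset.sum_mul]
        exact Finset.sum_congr rfl fun j _ => by rw [Pi.smul_apply, smul_eq_mul]; ring
      have hunit : IsUnit (1 - w) := by
        by_contra hnu
        have h1 : (1 - w) + w ∈ maximalIdeal R := Ideal.add_mem _ hnu hwm
        rw [sub_add_cancel] at h1
        exact h1 isUnit_one
      exact hunit.mul_right_eq_zero.1 hwx
    · rw [hcd, hd]; simp

theorem nonempty_unimodularTuples (hn : 1 ≤ n) : Nonempty (unimodularTuples R n) := by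
  obtain ⟨a, ha⟩ := redVec_surjective (R := R) (n := n) 1
  refine ⟨a, mem_unimodularTuples_iff.2 ?_⟩
  rw [ha]
  intro h
  exact one_ne_zero (congrFun h ⟨0, hn⟩)

theorem sum_unimodularTuples_ite [Fintype R] [Fintype (unimodularTuples R n)]
    (p : (Fin n → R) → Prop) [DecidablePred p] :
    ∑ b : unimodularTuples R n, (if p b then 1 else 0 : ℝ) =
      Nat.card {b // p b} - Nat.card {b : Fin n → R // (∀ i, b i ∈ maximalIdeal R) ∧ p b} := by
  classical
  have h := sum_unimodularTuples (fun b : Fin n → R => if redVec b = 0 then (0 : ℝ) else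
    if p b then 1 else 0) (fun b hb => if_pos hb)
  rw [Finset.sum_congr rfl fun b _ => if_neg (redVec_coe_ne_zero b)] at h
  rw [h, ← sum_ite_one_eq_natCard, ← sum_ite_one_eq_natCard, ← Finset.sum_sub_distrib]
  refine Finset.sum_congr rfl fun b _ => ?_
  simp only [redVec_eq_zero_iff]
  by_cases h1 : ∀ i, b i ∈ maximalIdeal R
  · rw [if_pos h1]; simp [h1]
  · simp only [h1, if_false, false_and, sub_zero]

variable [Finite R]

variable [Fintype R] [Fintype (unimodularTuples R n)]

open scoped Classical in
theorem sum_unit_dotProduct (a : unimodularTuples R n) :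
    ∑ b : unimodularTuples R n, (if (a : Fin n → R) ⬝ᵥ (b : Fin n → R) = 1 then 1 else 0 : ℝ) =
      ((Nat.card (ResidueField R) : ℝ) * Nat.card (maximalIdeal R)) ^ (n - 1) := by
  rw [sum_unimodularTuples (fun b => if (a : Fin n → R) ⬝ᵥ b = 1 then (1 : ℝ) else 0),
    sum_ite_one_eq_natCard]
  · rw [natCard_dotProduct_eq_top (redVec_coe_ne_zero a), natCard_eq_mul_maximalIdeal]
    push_cast
    rfl
  · intro b hb
    refine if_neg fun h => ?_
    have := residue_dotProduct (a : Fin n → R) b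
    rw [h, hb] at this
    simp at this

open scoped Classical in
theorem sum_unit_dotProduct_mul (a a' : unimodularTuples R n)
    (h : ∀ t : ResidueField R, redVec (a' : Fin n → R) ≠ t • redVec (a : Fin n → R)) :
    ∑ b : unimodularTuples R n, (if (a : Fin n → R) ⬝ᵥ (b : Fin n → R) = 1 then 1 else 0 : ℝ) *
        (if (a' : Fin n → R) ⬝ᵥ (b : Fin n → R) = 1 then 1 else 0 : ℝ) =
      ((Nat.card (ResidueField R) : ℝ) * Nat.card (maximalIdeal R)) ^ (n - 2) := by
  simp only [ite_zero_mul_ite_zero, mul_one]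
  rw [sum_unimodularTuples (fun b => if (a : Fin n → R) ⬝ᵥ b = 1 ∧ (a' : Fin n → R) ⬝ᵥ b = 1
    then (1 : ℝ) else 0),
    sum_ite_one_eq_natCard (fun b => (a : Fin n → R) ⬝ᵥ b = 1 ∧ (a' : Fin n → R) ⬝ᵥ b = 1)]
  · rw [natCard_dotProduct_eq_and_eq_top (redVec_coe_ne_zero a) h, natCard_eq_mul_maximalIdeal]
    push_cast
    rfl
  · intro b hb
    refine if_neg fun h => ?_
    have := residue_dotProduct (a : Fin n → R) b
    rw [h.1, hb] at this
    simp at this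

open scoped Classical in
theorem sum_zero_dotProduct (a : unimodularTuples R n) :
    ∑ b : unimodularTuples R n, (if (a : Fin n → R) ⬝ᵥ (b : Fin n → R) = 0 then 1 else 0 : ℝ) =
      ((Nat.card (ResidueField R) : ℝ) * Nat.card (maximalIdeal R)) ^ (n - 1) -
        (Nat.card (maximalIdeal R) : ℝ) ^ (n - 1) := by
  rw [sum_unimodularTuples_ite (fun b => (a : Fin n → R) ⬝ᵥ b = 0)]
  rw [natCard_dotProduct_eq_top (redVec_coe_ne_zero a),
    natCard_dotProduct_eq _ (redVec_coe_ne_zero a) (zero_mem _),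
    natCard_eq_mul_maximalIdeal]
  push_cast
  rfl

open scoped Classical in
theorem sum_zero_dotProduct_mul (a : unimodularTuples R n) (c : Fin n → R)
    (h : ∀ t : ResidueField R, redVec c ≠ t • redVec (a : Fin n → R)) :
    ∑ b : unimodularTuples R n, (if (a : Fin n → R) ⬝ᵥ (b : Fin n → R) = 0 then 1 else 0 : ℝ) *
        (if c ⬝ᵥ (b : Fin n → R) = 0 then 1 else 0 : ℝ) =
      ((Nat.card (ResidueField R) : ℝ) * Nat.card (maximalIdeal R)) ^ (n - 2) -
        (Nat.card (maximalIdeal R) : ℝ) ^ (n - 2) := by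
  simp only [ite_zero_mul_ite_zero, mul_one]
  rw [sum_unimodularTuples_ite (fun b => (a : Fin n → R) ⬝ᵥ b = 0 ∧ c ⬝ᵥ b = 0)]
  rw [natCard_dotProduct_eq_and_eq_top (redVec_coe_ne_zero a) h,
    natCard_dotProduct_eq_and_eq _ (redVec_coe_ne_zero a) h (zero_mem _) (zero_mem _),
    natCard_eq_mul_maximalIdeal]
  push_cast
  rfl

-- Writing `a' = s • a + x • c` with `c` off the line of `a`, every `b` orthogonal to `a` and `c` is
-- orthogonal to `a'`. So independent lines have the fewest common neighbours.
open scoped Classical in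
theorem le_sum_zero_dotProduct_mul [IsPrincipalIdealRing R] (hn : 2 ≤ n)
    (a a' : unimodularTuples R n) :
    ((Nat.card (ResidueField R) : ℝ) * Nat.card (maximalIdeal R)) ^ (n - 2) -
        (Nat.card (maximalIdeal R) : ℝ) ^ (n - 2) ≤
    ∑ b : unimodularTuples R n, (if (a : Fin n → R) ⬝ᵥ (b : Fin n → R) = 0 then 1 else 0 : ℝ) *
        (if (a' : Fin n → R) ⬝ᵥ (b : Fin n → R) = 0 then 1 else 0 : ℝ) := by
  obtain ⟨c, hc, s, x, hsx⟩ := exists_eq_smul_add_smul hn (redVec_coe_ne_zero a) (a' : Fin n → R)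
  rw [← sum_zero_dotProduct_mul a c hc]
  refine Finset.sum_le_sum fun b _ => ?_
  by_cases h1 : (a : Fin n → R) ⬝ᵥ (b : Fin n → R) = 0
  · by_cases h2 : c ⬝ᵥ (b : Fin n → R) = 0
    · have h3 : (a' : Fin n → R) ⬝ᵥ (b : Fin n → R) = 0 := by
        rw [hsx, add_dotProduct, smul_dotProduct, smul_dotProduct, h1, h2]; simp
      simp [h1, h2, h3]
    · simp only [h2, if_false, mul_zero]; positivity
  · simp [h1]

open scoped Classical in
theorem sum_sameLine_le (a : unimodularTuples R n) :
    ∑ a' : unimodularTuples R n, (if Submodule.span (ResidueField R) {redVec (a : Fin n → R)} =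
        Submodule.span (ResidueField R) {redVec (a' : Fin n → R)} then 1 else 0 : ℝ) ≤
      ((Nat.card (ResidueField R) : ℝ) - 1) * (Nat.card (maximalIdeal R) : ℝ) ^ n := by
  have := Fintype.ofFinite (ResidueField R)
  simp only [← exists_redVec_eq_smul_iff]
  have h := sum_unimodularTuples_comp_redVec (R := R) (n := n)
    (fun v => if v ≠ 0 ∧ ∃ t : ResidueField R, v = t • redVec (a : Fin n → R) then 1 else 0)
    (by simp)
  simp only [and_iff_right (redVec_coe_ne_zero _)] at h
  rw [h, mul_comm, sum_ite_one_eq_natCard (fun v => v ≠ 0 ∧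
    ∃ t : ResidueField R, v = t • redVec (a : Fin n → R))]
  refine mul_le_mul_of_nonneg_right ?_ (by positivity)
  have h1 : Nat.card {v // v ≠ 0 ∧ ∃ t : ResidueField R, v = t • redVec (a : Fin n → R)} ≤
      Nat.card (ResidueField R)ˣ := by
    refine Nat.card_le_card_of_surjective (fun u : (ResidueField R)ˣ =>
      ⟨(u : ResidueField R) • redVec (a : Fin n → R),
        smul_ne_zero u.ne_zero (redVec_coe_ne_zero a), u, rfl⟩) ?_
    rintro ⟨v, hv, t, rfl⟩
    have ht : t ≠ 0 := by rintro rfl; simp at hv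
    exact ⟨Units.mk0 t ht, rfl⟩
  have h2 : Nat.card (ResidueField R)ˣ + 1 = Nat.card (ResidueField R) := by
    rw [Nat.card_units]
    exact Nat.sub_add_cancel (natCard_residueField_pos R)
  have h3 : (Nat.card (ResidueField R)ˣ : ℝ) + 1 = Nat.card (ResidueField R) := by
    exact_mod_cast h2
  rw [← h3, add_sub_cancel_right]
  exact_mod_cast h1

theorem one_le_sqrt_natCard_residueField (R : Type*) [CommRing R] [IsLocalRing R] [Finite R] :
    1 ≤ √(Nat.card (ResidueField R) : ℝ) ∧
      √(Nat.card (ResidueField R) : ℝ) ≤ Nat.card (ResidueField R) := by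
  have h : (1 : ℝ) ≤ Nat.card (ResidueField R) := by exact_mod_cast natCard_residueField_pos R
  refine ⟨Real.one_le_sqrt.2 h, Real.sqrt_le_iff.2 ⟨by linarith, by nlinarith⟩⟩

open scoped Classical in
theorem sum_sum_mul_of_regular {V : Type*} [Fintype V] {A : V → V → ℝ} {d : ℝ}
    (hd : ∀ a, ∑ b, A a b = d) (hA : ∀ a b, A a b = A b a) (a : V) :
    ∑ a', ∑ b, A a b * A a' b = d ^ 2 := by
  rw [Finset.sum_comm]
  have : ∀ b, ∑ a', A a b * A a' b = A a b * d := fun b => by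
    rw [← Finset.mul_sum]
    simp only [hA _ b, hd]
  simp only [this, ← Finset.sum_mul, hd, sq]

/-- Here `T` is the same-line relation and `c = (qM)^(n-2)`. The row sums of the remainder are at
most `d² - c (|V| - (q-1) Mⁿ) = (M² q)^(n-1)`, with `d = (qM)^(n-1)` and `|V| = Mⁿ (qⁿ - 1)`. -/
theorem le_iso_Um (hn : 2 ≤ n) :
    (((Nat.card (ResidueField R) : ℝ) * Nat.card (maximalIdeal R)) ^ (n - 1) -
      (Nat.card (maximalIdeal R) * √(Nat.card (ResidueField R) : ℝ)) ^ (n - 1)) / 2 ≤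
      (Um R n).iso := by
  classical
  have := nonempty_unimodularTuples (R := R) (n := n) (by omega)
  obtain ⟨hs1, hs2⟩ := one_le_sqrt_natCard_residueField R
  have hs3 := Real.sq_sqrt (show 0 ≤ (Nat.card (ResidueField R) : ℝ) by positivity)
  have hM : (0 : ℝ) < Nat.card (maximalIdeal R) := by exact_mod_cast Nat.card_pos
  have hd := sum_unit_dotProduct (R := R) (n := n)
  have hsymm : ∀ a b : unimodularTuples R n,
      (if (a : Fin n → R) ⬝ᵥ (b : Fin n → R) = 1 then 1 else 0 : ℝ) =
      if (b : Fin n → R) ⬝ᵥ (a : Fin n → R) = 1 then 1 else 0 := fun a b => by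
    rw [dotProduct_comm]
  have hcard := card_unimodularTuples (R := R) (n := n)
  have hT := sum_sameLine_le (R := R) (n := n)
  have hco := sum_unit_dotProduct_mul (R := R) (n := n)
  refine le_iso_bipartiteGraphOf _ hd (fun b => ?_) (by positivity) ?_ fun f g hf _ => ?_
  · simp only [hsymm _ b, hd]
  · refine pow_le_pow_left₀ (by positivity) ?_ _
    rw [mul_comm]
    exact mul_le_mul_of_nonneg_right hs2 hM.le
  · have hpair := two_mul_sum_ite_mul_le
      (A := fun a b : unimodularTuples R n =>
        (if (a : Fin n → R) ⬝ᵥ (b : Fin n → R) = 1 then 1 else 0 : ℝ))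
      (T := fun a a' : unimodularTuples R n =>
        if Submodule.span (ResidueField R) {redVec (a : Fin n → R)} =
          Submodule.span (ResidueField R) {redVec (a' : Fin n → R)} then 1 else 0)
      (c := ((Nat.card (ResidueField R) : ℝ) * Nat.card (maximalIdeal R)) ^ (n - 2))
      (lam := (Nat.card (maximalIdeal R) * √(Nat.card (ResidueField R) : ℝ)) ^ (n - 1))
      (by positivity) rfl (by positivity) (fun a a' => by simp only [eq_comm])
      (sum_mul_ite_eq_nonneg _) (fun a a' => ?_) (fun a => ?_) f g hf
    · refine le_trans (le_of_eq ?_) hpair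
      congr 1
      refine Finset.sum_congr rfl fun a _ => Finset.sum_congr rfl fun b _ => ?_
      rw [ite_mul, one_mul, zero_mul]
    · by_cases h : ∃ t : ResidueField R, redVec (a' : Fin n → R) = t • redVec (a : Fin n → R)
      · rw [if_pos ((exists_redVec_eq_smul_iff a a').1 h), sub_self, mul_zero]
        positivity
      · rw [if_neg (mt (exists_redVec_eq_smul_iff a a').2 h), sub_zero, mul_one,
          hco a a' (not_exists.1 h)]
    · have h1 := sum_sum_mul_of_regular hd hsymm a
      rw [Finset.sum_sub_distrib, h1, ← Finset.mul_sum, Finset.sum_sub_distrib, Finset.sum_const,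
        Finset.card_univ, nsmul_eq_mul, mul_one, hcard]
      have h2 := mul_le_mul_of_nonneg_left (hT a) (show 0 ≤
        ((Nat.card (ResidueField R) : ℝ) * Nat.card (maximalIdeal R)) ^ (n - 2) by positivity)
      obtain ⟨N, rfl⟩ := Nat.exists_eq_add_of_le' hn
      simp only [Nat.add_sub_cancel, show N + 2 - 1 = N + 1 by omega] at h2 ⊢
      rw [mul_sub]
      refine le_trans (sub_le_sub_left (sub_le_sub_left h2 _) _) (le_of_eq ?_)
      set q := (Nat.card (ResidueField R) : ℝ)
      set M := (Nat.card (maximalIdeal R) : ℝ)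
      have h3 : ((M * √q) ^ (N + 1)) ^ 2 = (M ^ 2 * q) ^ (N + 1) := by
        rw [← pow_mul, mul_comm (N + 1) 2, pow_mul, mul_pow, hs3]
      rw [h3]
      ring

-- Here `T = 0` and `c` is the minimal number of common neighbours. The row sums are `d² - c |V| =
-- M^(2n-2) q^(n-2) (q-1)²`, because `(q^(n-1) - 1)² - (q^(n-2) - 1)(qⁿ - 1) = q^(n-2) (q-1)²`.
open scoped Classical in
theorem two_mul_sum_orthogonal_le [IsPrincipalIdealRing R] (hn : 2 ≤ n)
    (f g : unimodularTuples R n → ℝ) (hf : ∑ a, f a = 0) :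
    2 * ∑ a : unimodularTuples R n, ∑ b : unimodularTuples R n,
      (if (a : Fin n → R) ⬝ᵥ (b : Fin n → R) = 0 then 1 else 0 : ℝ) * (f a * g b) ≤
      ((Nat.card (maximalIdeal R) : ℝ) ^ (n - 1) * √(Nat.card (ResidueField R) : ℝ) ^ (n - 2) *
        ((Nat.card (ResidueField R) : ℝ) - 1)) * (∑ a, f a ^ 2 + ∑ b, g b ^ 2) := by
  obtain ⟨hs1, hs2⟩ := one_le_sqrt_natCard_residueField R
  have hs3 := Real.sq_sqrt (show 0 ≤ (Nat.card (ResidueField R) : ℝ) by positivity)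
  have hM : (0 : ℝ) < Nat.card (maximalIdeal R) := by exact_mod_cast Nat.card_pos
  have hq : (1 : ℝ) < Nat.card (ResidueField R) := by
    exact_mod_cast Finite.one_lt_card
  have hq' : 0 < (Nat.card (ResidueField R) : ℝ) - 1 := by linarith
  have hd := sum_zero_dotProduct (R := R) (n := n)
  have hsymm : ∀ a b : unimodularTuples R n,
      (if (a : Fin n → R) ⬝ᵥ (b : Fin n → R) = 0 then 1 else 0 : ℝ) =
      if (b : Fin n → R) ⬝ᵥ (a : Fin n → R) = 0 then 1 else 0 := fun a b => by
    rw [dotProduct_comm]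
  have hcard := card_unimodularTuples (R := R) (n := n)
  refine two_mul_sum_ite_mul_le (T := fun _ _ => 0)
    (c := ((Nat.card (ResidueField R) : ℝ) * Nat.card (maximalIdeal R)) ^ (n - 2) -
      (Nat.card (maximalIdeal R) : ℝ) ^ (n - 2))
    (by positivity) rfl (sub_nonneg.2 (pow_le_pow_left₀ hM.le (by nlinarith) _))
    (fun _ _ => rfl) (by simp) (fun a a' => ?_) (fun a => ?_) f g hf
  · rw [sub_zero, mul_one]
    exact le_sum_zero_dotProduct_mul hn a a'
  · have h1 := sum_sum_mul_of_regular hd hsymm a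
    rw [Finset.sum_sub_distrib, h1, Finset.sum_const, Finset.card_univ, nsmul_eq_mul, sub_zero,
      mul_one, hcard]
    obtain ⟨N, rfl⟩ := Nat.exists_eq_add_of_le' hn
    simp only [Nat.add_sub_cancel, show N + 2 - 1 = N + 1 by omega]
    set q := (Nat.card (ResidueField R) : ℝ)
    set M := (Nat.card (maximalIdeal R) : ℝ)
    have h3 : (M ^ (N + 1) * √q ^ N * (q - 1)) ^ 2 = (M ^ 2) ^ (N + 1) * q ^ N * (q - 1) ^ 2 := by
      rw [mul_pow, mul_pow, ← pow_mul √q, mul_comm N 2, pow_mul √q, hs3]; ring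
    rw [h3]
    refine le_of_eq ?_
    ring

end Local

/-! ### Passage to classes modulo units, and the lower bound for `Um₀` -/

namespace ProjUnimodular

variable {R : Type*} [CommRing R] {n : ℕ}

/-- The class of a unimodular tuple. -/
def mk (a : unimodularTuples R n) : ProjUnimodular R n := Quotient.mk _ a

theorem mk_surjective : Function.Surjective (mk : unimodularTuples R n → ProjUnimodular R n) :=
  Quotient.mk_surjective

theorem mk_eq_mk_iff {a b : unimodularTuples R n} : mk a = mk b ↔ ∃ u : Rˣ, u • b = a :=
  Quotient.eq.trans Iff.rfl

theorem orthogonal_mk_mk {a b : unimodularTuples R n} :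
    Orthogonal (mk a) (mk b) ↔ (a : Fin n → R) ⬝ᵥ (b : Fin n → R) = 0 := Iff.rfl

end ProjUnimodular

section Local

variable {R : Type*} [CommRing R] [IsLocalRing R] {n : ℕ}

theorem natCard_units_of_isLocalRing (R : Type*) [CommRing R] [IsLocalRing R] [Finite R] :
    (Nat.card Rˣ : ℝ) =
      ((Nat.card (ResidueField R) : ℝ) - 1) * Nat.card (maximalIdeal R) := by
  classical
  have e : Rˣ ≃ {x : R // x ∉ maximalIdeal R} :=
    { toFun := fun u => ⟨u, fun h => h u.isUnit⟩
      invFun := fun x => (not_not.1 x.2 : IsUnit x.1).unit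
      left_inv := fun u => by ext; rfl
      right_inv := fun x => rfl }
  have h1 : Nat.card (maximalIdeal R) + Nat.card {x : R // x ∉ maximalIdeal R} = Nat.card R := by
    rw [← Nat.card_congr (Equiv.sumCompl (fun x : R => x ∈ maximalIdeal R)), Nat.card_sum]
  rw [← Nat.card_congr e, natCard_eq_mul_maximalIdeal R] at h1
  have h2 : (Nat.card (maximalIdeal R) : ℝ) + Nat.card Rˣ =
    Nat.card (ResidueField R) * Nat.card (maximalIdeal R) := by exact_mod_cast h1
  linarith

namespace ProjUnimodular

/-- The action of the units is free, because a unimodular tuple has a unit entry. -/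
theorem natCard_fiber_mk (x : ProjUnimodular R n) : Nat.card {a // mk a = x} = Nat.card Rˣ := by
  obtain ⟨a, rfl⟩ := mk_surjective x
  symm
  refine Nat.card_congr (Equiv.ofBijective (fun u : Rˣ => ⟨u • a, mk_eq_mk_iff.2 ⟨u, rfl⟩⟩) ⟨?_, ?_⟩)
  · intro u v h
    obtain ⟨i, hi⟩ := exists_isUnit_of_redVec_ne_zero (redVec_coe_ne_zero a)
    have h1 : (u : R) * (a : Fin n → R) i = (v : R) * (a : Fin n → R) i :=
      congrFun (congrArg (fun z : {b // mk b = mk a} => ((z.1 : unimodularTuples R n) : Fin n → R)) h) i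
    exact Units.ext (hi.mul_left_inj.1 h1)
  · rintro ⟨b, hb⟩
    obtain ⟨u, rfl⟩ := mk_eq_mk_iff.1 hb
    exact ⟨u, rfl⟩

theorem sum_comp_mk [Fintype (unimodularTuples R n)] [Fintype (ProjUnimodular R n)]
    (h : ProjUnimodular R n → ℝ) : ∑ a, h (mk a) = (Nat.card Rˣ : ℝ) * ∑ x, h x := by
  classical
  rw [← Finset.sum_fiberwise (s := Finset.univ) (g := (mk : unimodularTuples R n → _)),
    Finset.mul_sum]
  refine Finset.sum_congr rfl fun x _ => ?_
  rw [Finset.sum_congr rfl (g := fun _ => h x) (fun a ha => by rw [(Finset.mem_filter.1 ha).2]),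
    Finset.sum_const, nsmul_eq_mul, ← Fintype.card_subtype, ← Nat.card_eq_fintype_card,
    natCard_fiber_mk]

theorem sum_sum_comp_mk [Fintype (unimodularTuples R n)] [Fintype (ProjUnimodular R n)]
    (h : ProjUnimodular R n → ProjUnimodular R n → ℝ) :
    ∑ a, ∑ b, h (mk a) (mk b) = (Nat.card Rˣ : ℝ) ^ 2 * ∑ x, ∑ y, h x y := by
  rw [Finset.sum_congr rfl (fun a _ => sum_comp_mk (h (mk a))),
    sum_comp_mk (fun x => (Nat.card Rˣ : ℝ) * ∑ y, h x y), ← Finset.mul_sum]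
  ring

end ProjUnimodular

open ProjUnimodular

variable [Finite R]

theorem natCard_units_pos (R : Type*) [CommRing R] [Finite R] : (0 : ℝ) < Nat.card Rˣ := by
  exact_mod_cast Nat.card_pos

open scoped Classical in
theorem natCard_redVec_eq_and_dotProduct_eq {a : Fin n → R} (ha : redVec a ≠ 0) (s : R)
    (w : Fin n → ResidueField R) :
    Nat.card {b : Fin n → R // redVec b = w ∧ a ⬝ᵥ b = s} =
      (if redVec a ⬝ᵥ w = residue R s then
        Nat.card (maximalIdeal R) ^ (n - 1) else 0) := by
  split_ifs with h
  · obtain ⟨b₀, rfl⟩ := redVec_surjective w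
    have hx : s - a ⬝ᵥ b₀ ∈ maximalIdeal R := by
      rw [← residue_eq_zero_iff, map_sub, residue_dotProduct, h, sub_self]
    rw [← natCard_dotProduct_eq _ ha hx]
    refine Nat.card_congr ((Equiv.subRight b₀).subtypeEquiv fun b => ?_)
    rw [← redVec_eq_zero_iff, Equiv.subRight_apply, map_sub, sub_eq_zero, dotProduct_sub,
      sub_left_inj]
  · rw [Nat.card_eq_zero]
    refine Or.inl ⟨fun ⟨b, hb, hs⟩ => h ?_⟩
    rw [← hb, ← residue_dotProduct, hs]

variable [Fintype R] [Fintype (unimodularTuples R n)]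

open scoped Classical in
theorem sum_orthogonal [Fintype (ProjUnimodular R n)] (hn : 2 ≤ n) (x : ProjUnimodular R n) :
    ∑ y, (if Orthogonal x y then 1 else 0 : ℝ) = (Nat.card (maximalIdeal R) : ℝ) ^ (n - 2) *
      (((Nat.card (ResidueField R) : ℝ) ^ (n - 1) - 1) / ((Nat.card (ResidueField R) : ℝ) - 1)) := by
  obtain ⟨a, rfl⟩ := mk_surjective x
  have h := sum_comp_mk (fun y => (if Orthogonal (mk a) y then 1 else 0 : ℝ))
  simp only [orthogonal_mk_mk] at h
  rw [sum_zero_dotProduct a, natCard_units_of_isLocalRing] at h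
  have hq : (1 : ℝ) < Nat.card (ResidueField R) := by exact_mod_cast Finite.one_lt_card
  have hM : (0 : ℝ) < Nat.card (maximalIdeal R) := by exact_mod_cast Nat.card_pos
  set q := (Nat.card (ResidueField R) : ℝ)
  set M := (Nat.card (maximalIdeal R) : ℝ)
  have hq' : q - 1 ≠ 0 := by linarith
  obtain ⟨N, rfl⟩ := Nat.exists_eq_add_of_le' hn
  simp only [Nat.add_sub_cancel, show N + 2 - 1 = N + 1 by omega] at h ⊢
  rw [mul_div_assoc', eq_div_iff hq']
  refine mul_left_cancel₀ hM.ne' ?_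
  rw [mul_pow] at h
  linear_combination -h

theorem le_iso_Um₀ [IsPrincipalIdealRing R] (hn : 2 ≤ n) :
    ((Nat.card (maximalIdeal R) : ℝ) ^ (n - 2) *
      (((Nat.card (ResidueField R) : ℝ) ^ (n - 1) - 1) / ((Nat.card (ResidueField R) : ℝ) - 1)) -
      (Nat.card (maximalIdeal R) : ℝ) ^ (n - 2) * √(Nat.card (ResidueField R) : ℝ) ^ (n - 2)) / 2 ≤
      (Um₀ R n).iso := by
  classical
  have : Fintype (ProjUnimodular R n) := Fintype.ofFinite _
  have : Nonempty (ProjUnimodular R n) :=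
    (nonempty_unimodularTuples (R := R) (n := n) (by omega)).map mk
  obtain ⟨hs1, hs2⟩ := one_le_sqrt_natCard_residueField R
  have hq : (1 : ℝ) < Nat.card (ResidueField R) := by exact_mod_cast Finite.one_lt_card
  have hM : (0 : ℝ) < Nat.card (maximalIdeal R) := by exact_mod_cast Nat.card_pos
  have hd := sum_orthogonal (R := R) hn
  have hsymm : ∀ x y : ProjUnimodular R n, Orthogonal x y ↔ Orthogonal y x := fun x y => by
    obtain ⟨a, rfl⟩ := mk_surjective x
    obtain ⟨b, rfl⟩ := mk_surjective y
    rw [orthogonal_mk_mk, orthogonal_mk_mk, dotProduct_comm]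
  refine le_iso_bipartiteGraphOf _ hd (fun b => ?_) (by positivity) ?_ fun f g hf _ => ?_
  · simp only [hsymm _ b, hd]
  · refine mul_le_mul_of_nonneg_left ?_ (by positivity)
    rw [le_div_iff₀ (by linarith)]
    obtain ⟨N, rfl⟩ := Nat.exists_eq_add_of_le' hn
    simp only [Nat.add_sub_cancel, show N + 2 - 1 = N + 1 by omega]
    set q := (Nat.card (ResidueField R) : ℝ)
    have h1 : √q ^ N ≤ q ^ N := pow_le_pow_left₀ (by positivity) hs2 _
    have h2 : 1 ≤ q ^ N := one_le_pow₀ hq.le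
    have h3 := mul_le_mul_of_nonneg_right h1 (show 0 ≤ q - 1 by linarith)
    rw [pow_succ]
    linarith
  · have hU := natCard_units_pos R
    have hf' : ∑ a : unimodularTuples R n, f (mk a) = 0 := by rw [sum_comp_mk, hf, mul_zero]
    -- Lifting to tuples multiplies the form by `|Rˣ|²` and the norms by `|Rˣ|`, so the constant is
    -- divided by `|Rˣ| = (q-1) M`.
    have h := two_mul_sum_orthogonal_le hn (fun a => f (mk a)) (fun a => g (mk a)) hf'
    rw [sum_comp_mk (fun x => f x ^ 2), sum_comp_mk (fun x => g x ^ 2), ← mul_add] at h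
    simp only [← orthogonal_mk_mk] at h
    rw [sum_sum_comp_mk (fun x y => (if Orthogonal x y then 1 else 0 : ℝ) * (f x * g y))] at h
    have e : ∑ x, ∑ y, (if Orthogonal x y then 1 else 0 : ℝ) * (f x * g y) =
        ∑ x, ∑ y, if Orthogonal x y then f x * g y else 0 :=
      Finset.sum_congr rfl fun x _ => Finset.sum_congr rfl fun y _ => by
        rw [ite_mul, one_mul, zero_mul]
    rw [e] at h
    refine le_of_mul_le_mul_left ?_ (pow_pos hU 2)
    refine (le_of_eq (by ring)).trans (h.trans (le_of_eq ?_))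
    rw [natCard_units_of_isLocalRing]
    obtain ⟨N, rfl⟩ := Nat.exists_eq_add_of_le' hn
    simp only [Nat.add_sub_cancel, show N + 2 - 1 = N + 1 by omega]
    ring

/-! ### Upper bounds from sign functions on the residue space -/

-- Each residue vector `v` has `Mⁿ` lifts; given one with `v ≠ 0`, each residue solution `w` has
-- `M^(n-1)` lifts solving the equation over `R`.
open scoped Classical in
theorem sum_dotProduct_comp_redVec [Fintype (ResidueField R)]
    (F G : (Fin n → ResidueField R) → ℝ) (hF : F 0 = 0) (hG : G 0 = 0) (s : R) :
    ∑ a : unimodularTuples R n, ∑ b : unimodularTuples R n,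
      (if (a : Fin n → R) ⬝ᵥ (b : Fin n → R) = s then
        F (redVec (a : Fin n → R)) * G (redVec (b : Fin n → R)) else 0) =
      (Nat.card (maximalIdeal R) : ℝ) ^ (n + (n - 1)) *
        ∑ v, ∑ w, if v ⬝ᵥ w = residue R s then F v * G w else 0 := by
  have key : ∀ a : unimodularTuples R n, ∑ b : unimodularTuples R n,
      (if (a : Fin n → R) ⬝ᵥ (b : Fin n → R) = s then
        F (redVec (a : Fin n → R)) * G (redVec (b : Fin n → R)) else 0) =
      (Nat.card (maximalIdeal R) : ℝ) ^ (n - 1) *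
        ∑ w, if redVec (a : Fin n → R) ⬝ᵥ w = residue R s then
          F (redVec (a : Fin n → R)) * G w else 0 := by
    intro a
    rw [sum_unimodularTuples (fun b => if (a : Fin n → R) ⬝ᵥ b = s then
        F (redVec (a : Fin n → R)) * G (redVec b) else 0) (fun b hb => by simp [hb, hG]),
      ← Finset.sum_fiberwise (s := Finset.univ) (g := fun b : Fin n → R => redVec b),
      Finset.mul_sum]
    refine Finset.sum_congr rfl fun w _ => ?_
    rw [Finset.sum_congr rfl (g := fun b => (if (a : Fin n → R) ⬝ᵥ b = s then 1 else 0 : ℝ) *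
        (F (redVec (a : Fin n → R)) * G w)) (fun b hb => by
          rw [(Finset.mem_filter.1 hb).2, ite_mul, one_mul, zero_mul]), ← Finset.sum_mul,
      Finset.sum_filter]
    have h1 := natCard_redVec_eq_and_dotProduct_eq (redVec_coe_ne_zero a) s w
    have h2 := sum_ite_one_eq_natCard (fun b => redVec b = w ∧ (a : Fin n → R) ⬝ᵥ b = s)
    simp only [ite_and] at h2
    rw [h2, h1]
    split_ifs <;> simp
  simp only [key]
  rw [← Finset.mul_sum, sum_unimodularTuples_comp_redVec
    (fun v => ∑ w, if v ⬝ᵥ w = residue R s then F v * G w else 0) (by simp [hF]), pow_add]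
  ring

open scoped Classical in
theorem iso_Um_le [Fintype (ResidueField R)] (hn : 2 ≤ n) {F G : (Fin n → ResidueField R) → ℝ}
    (hF : ∀ v, v ≠ 0 → F v = 1 ∨ F v = -1) (hG : ∀ v, v ≠ 0 → G v = 1 ∨ G v = -1)
    (hF0 : F 0 = 0) (hG0 : G 0 = 0) (hFs : ∑ v, F v = 0) (hGs : ∑ v, G v = 0) {c : ℝ}
    (hc : |∑ v, ∑ w, if v ⬝ᵥ w = 1 then F v * G w else 0| =
      c * ((Nat.card (ResidueField R) : ℝ) ^ n - 1)) :
    (Um R n).iso ≤ (((Nat.card (ResidueField R) : ℝ) * Nat.card (maximalIdeal R)) ^ (n - 1) -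
      (Nat.card (maximalIdeal R) : ℝ) ^ (n - 1) * c) / 2 := by
  have := nonempty_unimodularTuples (R := R) (n := n) (by omega)
  have hd := sum_unit_dotProduct (R := R) (n := n)
  refine iso_bipartiteGraphOf_le _ hd (fun b => ?_) (fun a => F (redVec (a : Fin n → R)))
    (fun a => G (redVec (a : Fin n → R))) (fun a => hF _ (redVec_coe_ne_zero a))
    (fun a => hG _ (redVec_coe_ne_zero a)) ?_ ?_ ?_
  · simp only [dotProduct_comm _ (b : Fin n → R), hd]
  · rw [sum_unimodularTuples_comp_redVec F hF0, hFs, mul_zero]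
  · rw [sum_unimodularTuples_comp_redVec G hG0, hGs, mul_zero]
  · rw [sum_dotProduct_comp_redVec F G hF0 hG0 1, map_one, abs_mul, hc, card_unimodularTuples,
      abs_of_nonneg (by positivity), pow_add]
    ring

open scoped Classical in
theorem iso_Um₀_le [Fintype (ResidueField R)] (hn : 2 ≤ n) {F G : (Fin n → ResidueField R) → ℝ}
    (hF : ∀ v, v ≠ 0 → F v = 1 ∨ F v = -1) (hG : ∀ v, v ≠ 0 → G v = 1 ∨ G v = -1)
    (hF0 : F 0 = 0) (hG0 : G 0 = 0) (hFs : ∑ v, F v = 0) (hGs : ∑ v, G v = 0)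
    (hFu : ∀ u : ResidueField R, u ≠ 0 → ∀ v, F (u • v) = F v)
    (hGu : ∀ u : ResidueField R, u ≠ 0 → ∀ v, G (u • v) = G v) {c : ℝ}
    (hc : |∑ v, ∑ w, if v ⬝ᵥ w = 0 then F v * G w else 0| =
      c * ((Nat.card (ResidueField R) : ℝ) - 1) * ((Nat.card (ResidueField R) : ℝ) ^ n - 1)) :
    (Um₀ R n).iso ≤ ((Nat.card (maximalIdeal R) : ℝ) ^ (n - 2) *
      (((Nat.card (ResidueField R) : ℝ) ^ (n - 1) - 1) / ((Nat.card (ResidueField R) : ℝ) - 1)) -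
      (Nat.card (maximalIdeal R) : ℝ) ^ (n - 2) * c) / 2 := by
  have : Fintype (ProjUnimodular R n) := Fintype.ofFinite _
  have : Nonempty (ProjUnimodular R n) :=
    (nonempty_unimodularTuples (R := R) (n := n) (by omega)).map mk
  have hd := sum_orthogonal (R := R) hn
  have hsymm : ∀ x y : ProjUnimodular R n, Orthogonal x y ↔ Orthogonal y x := fun x y => by
    obtain ⟨a, rfl⟩ := mk_surjective x
    obtain ⟨b, rfl⟩ := mk_surjective y
    rw [orthogonal_mk_mk, orthogonal_mk_mk, dotProduct_comm]
  have hU := natCard_units_pos R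
  -- Invariance under residue scalars makes the pulled-back sign constant on orbits of `Rˣ`.
  have hlift : ∀ H : (Fin n → ResidueField R) → ℝ,
      (∀ u : ResidueField R, u ≠ 0 → ∀ v, H (u • v) = H v) →
      ∃ h : ProjUnimodular R n → ℝ, ∀ a, h (mk a) = H (redVec (a : Fin n → R)) := by
    intro H hH
    refine ⟨Quotient.lift (fun a : unimodularTuples R n => H (redVec (a : Fin n → R))) ?_,
      fun a => rfl⟩
    rintro a b ⟨u, rfl⟩
    exact (congrArg H (redVec_smul (u : R) (b : Fin n → R))).trans
      (hH _ (u.isUnit.map (residue R)).ne_zero _)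
  obtain ⟨f, hf⟩ := hlift F hFu
  obtain ⟨g, hg⟩ := hlift G hGu
  refine iso_bipartiteGraphOf_le _ hd (fun b => ?_) f g (fun x => ?_) (fun x => ?_) ?_ ?_ ?_
  · simp only [hsymm _ b, hd]
  · obtain ⟨a, rfl⟩ := mk_surjective x
    rw [hf]; exact hF _ (redVec_coe_ne_zero a)
  · obtain ⟨a, rfl⟩ := mk_surjective x
    rw [hg]; exact hG _ (redVec_coe_ne_zero a)
  · have h := sum_comp_mk f
    simp only [hf] at h
    rw [sum_unimodularTuples_comp_redVec F hF0, hFs, mul_zero] at h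
    exact (mul_eq_zero.1 h.symm).resolve_left hU.ne'
  · have h := sum_comp_mk g
    simp only [hg] at h
    rw [sum_unimodularTuples_comp_redVec G hG0, hGs, mul_zero] at h
    exact (mul_eq_zero.1 h.symm).resolve_left hU.ne'
  · have h := sum_sum_comp_mk (R := R) (n := n) (fun x y => if Orthogonal x y then f x * g y else 0)
    simp only [hf, hg, orthogonal_mk_mk] at h
    rw [sum_dotProduct_comp_redVec F G hF0 hG0 0, map_zero] at h
    have h2 := congrArg abs h
    rw [abs_mul, abs_mul, hc, abs_of_nonneg (by positivity), abs_of_nonneg (by positivity)] at h2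
    have h3 := sum_comp_mk (R := R) (n := n) (fun _ => 1)
    simp only [Finset.sum_const, Finset.card_univ, nsmul_eq_mul, mul_one] at h3
    rw [card_unimodularTuples] at h3
    -- The factor `q - 1` in `hc` is absorbed by `|Rˣ| = (q-1) M`.
    refine mul_left_cancel₀ (pow_pos hU 2).ne' ?_
    have e : (Nat.card Rˣ : ℝ) ^ 2 * ((Nat.card (maximalIdeal R) : ℝ) ^ (n - 2) * c *
        Fintype.card (ProjUnimodular R n)) = Nat.card Rˣ * (Nat.card (maximalIdeal R) : ℝ) ^ (n - 2)
        * c * (Nat.card Rˣ * Fintype.card (ProjUnimodular R n)) := by ring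
    rw [← h2, e, ← h3, natCard_units_of_isLocalRing]
    obtain ⟨N, rfl⟩ := Nat.exists_eq_add_of_le' hn
    simp only [Nat.add_sub_cancel, show N + 2 - 1 = N + 1 by omega]
    ring

end Local

/-! ### Quadratic character sums over elements of given trace -/

theorem ringChar_ne_two_of_odd_card {F : Type*} [Field F] [Fintype F] (hk : Odd (Fintype.card F)) :
    ringChar F ≠ 2 := fun h => by
  have h1 := FiniteField.even_card_iff_char_two.1 h
  rw [Nat.odd_iff] at hk
  omega

section TraceSums

open scoped Classical

variable {k L : Type*} [Field k] [Field L] [Fintype L] [Algebra k L]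

/-- The quadratic character of a finite field summed over the elements of given trace. -/
noncomputable def quadraticTraceSum (L : Type*) {k : Type*} [Field k] [Field L] [Fintype L]
    [Algebra k L] (c : k) : ℤ :=
  ∑ γ : L, if Algebra.trace k L γ = c then quadraticChar L γ else 0

theorem quadraticTraceSum_mul (u c : k) (hu : u ≠ 0) :
    quadraticTraceSum L (u * c) = quadraticChar L (algebraMap k L u) * quadraticTraceSum L c := by
  have hu' : algebraMap k L u ≠ 0 := by simpa using hu
  rw [quadraticTraceSum, ← Equiv.sum_comp (Equiv.mulLeft₀ (algebraMap k L u) hu'),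
    quadraticTraceSum, Finset.mul_sum]
  refine Finset.sum_congr rfl fun γ _ => ?_
  have h1 : Algebra.trace k L (algebraMap k L u * γ) = u * Algebra.trace k L γ := by
    rw [← Algebra.smul_def, map_smul, smul_eq_mul]
  rw [Equiv.mulLeft₀_apply, h1, map_mul, mul_ite, mul_zero]
  simp only [mul_right_inj' hu]

/-- For each `α ≠ 0`, substituting `γ = α β` turns the inner sum into the trace sum; `α = 0`
contributes nothing. -/
theorem sum_sum_trace_mul (s : k) :
    ∑ α : L, ∑ β : L, (if Algebra.trace k L (α * β) = s then
      quadraticChar L α * quadraticChar L β else 0) =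
      ((Fintype.card L : ℤ) - 1) * quadraticTraceSum L s := by
  have h : ∀ α : L, ∑ β : L, (if Algebra.trace k L (α * β) = s then
      quadraticChar L α * quadraticChar L β else 0) =
      quadraticTraceSum L s - if α = 0 then quadraticTraceSum L s else 0 := by
    intro α
    split_ifs with hα
    · simp [hα]
    · rw [sub_zero, quadraticTraceSum, ← Equiv.sum_comp (Equiv.mulLeft₀ α hα)
        (fun γ => if Algebra.trace k L γ = s then quadraticChar L γ else 0)]
      simp only [Equiv.mulLeft₀_apply, map_mul]
  rw [Finset.sum_congr rfl fun α _ => h α, Finset.sum_sub_distrib]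
  simp
  ring

variable [Fintype k]

/-- By Euler's criterion in both fields, with `(qⁿ - 1)/2 = ((q - 1)/2) (1 + q + ⋯ + q^(n-1))`,
where the last factor is a sum of `n` odd numbers and so has the parity of `n`. -/
theorem quadraticChar_algebraMap (hk : Odd (Fintype.card k)) (u : k) (hu : u ≠ 0) :
    quadraticChar L (algebraMap k L u) = quadraticChar k u ^ Module.finrank k L := by
  have hcardL : Fintype.card L = Fintype.card k ^ Module.finrank k L := Module.card_eq_pow_finrank
  have hcharL : ringChar L ≠ 2 := ringChar_ne_two_of_odd_card (by rw [hcardL]; exact hk.pow)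
  have hchark : ringChar k ≠ 2 := ringChar_ne_two_of_odd_card hk
  set n := Module.finrank k L
  set q := Fintype.card k
  obtain ⟨r, hr⟩ := hk
  have hgeom : (∑ i ∈ Finset.range n, q ^ i) * (2 * r) + 1 = q ^ n := by
    have h2 := geom_sum_mul_add (2 * r) n
    rw [← hr] at h2
    exact h2
  have hdiv : Fintype.card L / 2 = r * ∑ i ∈ Finset.range n, q ^ i := by
    rw [hcardL, ← hgeom, show (∑ i ∈ Finset.range n, q ^ i) * (2 * r) + 1 =
      2 * (r * ∑ i ∈ Finset.range n, q ^ i) + 1 by ring]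
    omega
  have hpar : (-1 : ℤ) ^ (∑ i ∈ Finset.range n, q ^ i) = (-1) ^ n := by
    rw [← Finset.prod_pow_eq_pow_sum, Finset.prod_congr rfl (g := fun _ => (-1 : ℤ)),
      Finset.prod_const, Finset.card_range]
    exact fun i _ => (Odd.pow ⟨r, hr⟩).neg_one_pow
  have h1 := quadraticChar_eq_pow_of_char_ne_two' hcharL (algebraMap k L u)
  have h2 := quadraticChar_eq_pow_of_char_ne_two' hchark u
  rw [hdiv, pow_mul, ← map_pow, show r = q / 2 by omega, ← h2, map_intCast] at h1
  -- Signs may be compared after casting to `L`, whose characteristic is not two.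
  have hinj : ∀ x y : ℤ, (x = 1 ∨ x = -1) → (y = 1 ∨ y = -1) → (x : L) = y → x = y := by
    have hne : (1 : L) ≠ -1 := (Ring.neg_one_ne_one_of_char_ne_two hcharL).symm
    rintro x y (rfl | rfl) (rfl | rfl) h
    · rfl
    · exact absurd (by simpa using h) hne
    · exact absurd (by simpa using h.symm) hne
    · rfl
  have hu' : algebraMap k L u ≠ 0 := by simpa using hu
  refine hinj _ _ (quadraticChar_dichotomy hu') ?_ (h1.trans ?_)
  · rcases quadraticChar_dichotomy hu with h | h <;> rw [h]
    · simp
    · exact neg_one_pow_eq_or ℤ n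
  · rcases quadraticChar_dichotomy hu with h | h <;> rw [h]
    · simp
    · rw [← hpar]; simp

theorem sum_mul_quadraticTraceSum {A : Type*} [CommRing A] (h : k → A) :
    ∑ c, h c * (quadraticTraceSum L c : A) =
      ∑ γ : L, h (Algebra.trace k L γ) * (quadraticChar L γ : A) := by
  simp only [quadraticTraceSum, Int.cast_sum, Finset.mul_sum]
  rw [Finset.sum_comm]
  refine Finset.sum_congr rfl fun γ _ => ?_
  rw [Finset.sum_eq_single (Algebra.trace k L γ)]
  · simp
  · intro c _ hc; simp [hc.symm]
  · simp

/-- The sum is the Gauss sum of the quadratic character of `L` for the additive character `ψ ∘ Tr`,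
which is nontrivial because the trace is surjective. -/
theorem sum_mul_quadraticTraceSum_sq (hk : Odd (Fintype.card k)) :
    ∃ ψ : AddChar k ℂ, ψ.IsPrimitive ∧ (∑ c, ψ c * (quadraticTraceSum L c : ℂ)) ^ 2 =
      quadraticChar L (-1) * (Fintype.card k : ℂ) ^ Module.finrank k L := by
  have hcardL : Fintype.card L = Fintype.card k ^ Module.finrank k L := Module.card_eq_pow_finrank
  have hcharL : ringChar L ≠ 2 := ringChar_ne_two_of_odd_card (by rw [hcardL]; exact hk.pow)
  obtain ⟨ψ, hψ⟩ : ∃ ψ : AddChar k ℂ, ψ ≠ 1 := by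
    obtain ⟨ψ, hψ⟩ := (AddChar.exists_apply_ne_zero (α := k) (a := 1)).2 one_ne_zero
    exact ⟨ψ, fun h => hψ (by rw [h]; rfl)⟩
  refine ⟨ψ, AddChar.IsPrimitive.of_ne_one hψ, ?_⟩
  set Ψ : AddChar L ℂ := ψ.compAddMonoidHom (Algebra.trace k L).toAddMonoidHom with hΨdef
  have hΨ : Ψ.IsPrimitive := by
    refine AddChar.IsPrimitive.of_ne_one ?_
    obtain ⟨c, hc⟩ := AddChar.ne_one_iff.1 hψ
    obtain ⟨γ, rfl⟩ := Algebra.trace_surjective k L c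
    exact AddChar.ne_one_iff.2 ⟨γ, hc⟩
  have h := gaussSum_sq (χ := (quadraticChar L).ringHomComp (Int.castRingHom ℂ))
    (fun h => quadraticChar_ne_one hcharL
      (MulChar.injective_ringHomComp Int.cast_injective (h.trans (MulChar.ringHomComp_one _).symm)))
    ((quadraticChar_isQuadratic L).comp _) hΨ
  rw [sum_mul_quadraticTraceSum]
  have e : ∑ γ : L, ψ (Algebra.trace k L γ) * (quadraticChar L γ : ℂ) =
      gaussSum ((quadraticChar L).ringHomComp (Int.castRingHom ℂ)) Ψ := by
    rw [gaussSum]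
    exact Finset.sum_congr rfl fun γ _ => mul_comm _ _
  rw [e, h, hcardL]
  simp

/-- In odd degree the character of `L` restricts to that of `k`, so `S(c) = χ(c) S(1)`. The Gauss
sum of `L` is therefore `S(1)` times that of `k`, and squaring leaves `q^(n-1)`. -/
theorem quadraticTraceSum_one_sq_of_odd (hk : Odd (Fintype.card k))
    (hn : Odd (Module.finrank k L)) :
    quadraticTraceSum L (1 : k) ^ 2 = (Fintype.card k : ℤ) ^ (Module.finrank k L - 1) := by
  have hchark := ringChar_ne_two_of_odd_card hk
  have hχ : ∀ u : k, u ≠ 0 → quadraticChar L (algebraMap k L u) = quadraticChar k u := by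
    intro u hu
    rw [quadraticChar_algebraMap hk u hu]
    rcases quadraticChar_dichotomy hu with h | h <;> rw [h]
    · simp
    · exact hn.neg_one_pow
  have h0 : quadraticTraceSum L (0 : k) = 0 := by
    obtain ⟨u, hu⟩ := quadraticChar_exists_neg_one hchark
    have hu0 : u ≠ 0 := by rintro rfl; simp at hu
    have h := quadraticTraceSum_mul (L := L) u 0 hu0
    rw [mul_zero, hχ u hu0, hu] at h
    omega
  have hS : ∀ c : k, quadraticTraceSum L c = quadraticChar k c * quadraticTraceSum L (1 : k) := by
    intro c
    by_cases hc : c = 0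
    · rw [hc, h0]; simp
    · rw [← hχ c hc, ← quadraticTraceSum_mul c 1 hc, mul_one]
  obtain ⟨ψ, hψ, h⟩ := sum_mul_quadraticTraceSum_sq (L := L) hk
  have hg := gaussSum_sq (χ := (quadraticChar k).ringHomComp (Int.castRingHom ℂ))
    (fun h => quadraticChar_ne_one hchark
      (MulChar.injective_ringHomComp Int.cast_injective (h.trans (MulChar.ringHomComp_one _).symm)))
    ((quadraticChar_isQuadratic k).comp _) hψ
  have e : ∑ c, ψ c * (quadraticTraceSum L c : ℂ) = quadraticTraceSum L (1 : k) *
      gaussSum ((quadraticChar k).ringHomComp (Int.castRingHom ℂ)) ψ := by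
    rw [gaussSum, Finset.mul_sum]
    refine Finset.sum_congr rfl fun c _ => ?_
    rw [hS c]
    simp only [MulChar.ringHomComp_apply, eq_intCast]
    push_cast
    ring
  have h1 : quadraticChar L (-1) = quadraticChar k (-1) := by
    rw [← hχ (-1) (by simp)]; simp
  rw [e, mul_pow, hg, h1] at h
  have hne : ((quadraticChar k (-1) : ℤ) : ℂ) ≠ 0 := by
    rcases quadraticChar_dichotomy (F := k) (a := -1) (by simp) with h | h <;> rw [h] <;> simp
  have hq : (Fintype.card k : ℂ) ≠ 0 := by simp
  have h2 : (quadraticTraceSum L (1 : k) : ℂ) ^ 2 =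
      (Fintype.card k : ℂ) ^ (Module.finrank k L - 1) := by
    refine mul_right_cancel₀ (mul_ne_zero hne hq) ?_
    refine Eq.trans h ?_
    conv_lhs => rw [← Nat.sub_add_cancel hn.pos, pow_succ]
    ring
  exact_mod_cast h2

/-- In even degree the character is trivial on `kˣ`, so `S` is constant off zero. Its total is zero,
which gives `S(0)`; its transform is `S(0) - S(1) = -q S(1)`, whose square is `qⁿ`. -/
theorem quadraticTraceSum_of_even (hk : Odd (Fintype.card k))
    (hn : Even (Module.finrank k L)) :
    quadraticTraceSum L (1 : k) ^ 2 = (Fintype.card k : ℤ) ^ (Module.finrank k L - 2) ∧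
    quadraticTraceSum L (0 : k) = -((Fintype.card k - 1 : ℤ) * quadraticTraceSum L (1 : k)) := by
  have hpos : 0 < Module.finrank k L := Module.finrank_pos
  have hcardL : Fintype.card L = Fintype.card k ^ Module.finrank k L := Module.card_eq_pow_finrank
  have hcharL : ringChar L ≠ 2 := ringChar_ne_two_of_odd_card (by rw [hcardL]; exact hk.pow)
  have hχ : ∀ u : k, u ≠ 0 → quadraticChar L (algebraMap k L u) = 1 := by
    intro u hu
    rw [quadraticChar_algebraMap hk u hu]
    rcases quadraticChar_dichotomy hu with h | h <;> rw [h]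
    · simp
    · exact hn.neg_one_pow
  have hS : ∀ c : k, quadraticTraceSum L c = (if c = 0 then
      quadraticTraceSum L (0 : k) - quadraticTraceSum L (1 : k) else 0) +
      quadraticTraceSum L (1 : k) := by
    intro c
    split_ifs with hc
    · rw [hc]; ring
    · have := quadraticTraceSum_mul (L := L) c 1 hc
      rw [mul_one, hχ c hc] at this
      rw [this]; ring
  have hsum : quadraticTraceSum L (0 : k) - quadraticTraceSum L (1 : k) +
      Fintype.card k * quadraticTraceSum L (1 : k) = 0 := by
    have h := sum_mul_quadraticTraceSum (L := L) (fun _ : k => (1 : ℤ))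
    simp only [one_mul, Int.cast_id, quadraticChar_sum_zero hcharL] at h
    rw [Finset.sum_congr rfl fun c _ => hS c, Finset.sum_add_distrib] at h
    simpa using h
  refine ⟨?_, by linarith⟩
  obtain ⟨ψ, hψ, h⟩ := sum_mul_quadraticTraceSum_sq (L := L) hk
  have hψ1 : ψ ≠ 1 := fun h => by
    refine hψ one_ne_zero ?_
    rw [h]; ext; simp
  have e : ∑ c, ψ c * (quadraticTraceSum L c : ℂ) =
      ((quadraticTraceSum L (0 : k) - quadraticTraceSum L (1 : k) : ℤ) : ℂ) := by
    have : ∀ c, ψ c * (quadraticTraceSum L c : ℂ) = (if c = 0 then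
        ((quadraticTraceSum L (0 : k) - quadraticTraceSum L (1 : k) : ℤ) : ℂ) else 0) +
        ψ c * quadraticTraceSum L (1 : k) := by
      intro c
      rw [hS c]
      split_ifs with hc
      · rw [hc, AddChar.map_zero_eq_one]; push_cast; ring
      · push_cast; ring
    rw [Finset.sum_congr rfl fun c _ => this c, Finset.sum_add_distrib, ← Finset.sum_mul,
      AddChar.sum_eq_zero_of_ne_one hψ1]
    simp
  have h1 : quadraticChar L (-1) = 1 := by
    rw [← hχ (-1) (by simp)]; simp
  rw [e, h1, Int.cast_one, one_mul] at h
  have h2 : (quadraticTraceSum L (0 : k) - quadraticTraceSum L (1 : k)) ^ 2 =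
      (Fintype.card k : ℤ) ^ Module.finrank k L := by exact_mod_cast h
  have h3 : quadraticTraceSum L (0 : k) - quadraticTraceSum L (1 : k) =
      -(Fintype.card k * quadraticTraceSum L (1 : k)) := by linarith
  have hq : (Fintype.card k : ℤ) ≠ 0 := by simp
  rw [h3, neg_sq, mul_pow] at h2
  have h4 : 2 ≤ Module.finrank k L := by
    obtain ⟨r, hr⟩ := hn; omega
  refine mul_left_cancel₀ (pow_ne_zero 2 hq) ?_
  rw [h2, ← pow_add]
  congr 1; omega

end TraceSums

theorem trace_equivFun_symm_mul {k L ι : Type*} [Field k] [Field L] [Algebra k L]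
    [FiniteDimensional k L] [Algebra.IsSeparable k L] [Fintype ι] [DecidableEq ι]
    (b : Module.Basis ι k L) (v w : ι → k) :
    Algebra.trace k L (b.equivFun.symm v * b.traceDual.equivFun.symm w) = v ⬝ᵥ w := by
  simp only [Module.Basis.equivFun_symm_apply, Finset.sum_mul_sum, map_sum,
    smul_mul_smul_comm, map_smul, Module.Basis.trace_mul_traceDual, dotProduct]
  simp

open scoped Classical in
/-- Balanced sign functions on the nonzero vectors of `kⁿ` that are singular vectors of the
incidence relations `v ⬝ᵥ w = 1` and `v ⬝ᵥ w = 0`. They come from the quadratic character of the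
extension of `k` of degree `n`. -/
theorem exists_sign_functions (k : Type*) [Field k] [Fintype k] (hk : Odd (Nat.card k)) {n : ℕ}
    (hn : 1 ≤ n) : ∃ F G : (Fin n → k) → ℝ,
      (∀ v, v ≠ 0 → F v = 1 ∨ F v = -1) ∧ (∀ v, v ≠ 0 → G v = 1 ∨ G v = -1) ∧
      F 0 = 0 ∧ G 0 = 0 ∧ ∑ v, F v = 0 ∧ ∑ v, G v = 0 ∧
      (Odd n → |∑ v, ∑ w, if v ⬝ᵥ w = 1 then F v * G w else 0| =
        √(Nat.card k : ℝ) ^ (n - 1) * ((Nat.card k : ℝ) ^ n - 1)) ∧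
      (Even n → |∑ v, ∑ w, if v ⬝ᵥ w = 1 then F v * G w else 0| =
          √(Nat.card k : ℝ) ^ (n - 2) * ((Nat.card k : ℝ) ^ n - 1) ∧
        (∀ u : k, u ≠ 0 → ∀ v, F (u • v) = F v) ∧ (∀ u : k, u ≠ 0 → ∀ v, G (u • v) = G v) ∧
        |∑ v, ∑ w, if v ⬝ᵥ w = 0 then F v * G w else 0| =
          √(Nat.card k : ℝ) ^ (n - 2) * ((Nat.card k : ℝ) - 1) * ((Nat.card k : ℝ) ^ n - 1)) := by
  obtain ⟨p, hp⟩ := CharP.exists k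
  have : Fact p.Prime := ⟨CharP.char_is_prime k p⟩
  have : NeZero n := ⟨by omega⟩
  let L := FiniteField.Extension k p n
  have : Fintype L := Fintype.ofFinite L
  have hrank : Module.finrank k L = n := FiniteField.finrank_extension k p n
  rw [Nat.card_eq_fintype_card] at hk ⊢
  have hcardL : Fintype.card L = Fintype.card k ^ n := by
    rw [Module.card_eq_pow_finrank (K := k) (V := L), hrank]
  have hcharL : ringChar L ≠ 2 := ringChar_ne_two_of_odd_card (by rw [hcardL]; exact hk.pow)
  let b : Module.Basis (Fin n) k L := Module.finBasisOfFinrankEq k L hrank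
  have hgen : ∀ e : (Fin n → k) ≃ₗ[k] L,
      (∀ v, v ≠ 0 → ((quadraticChar L (e v) : ℤ) : ℝ) = 1 ∨
        ((quadraticChar L (e v) : ℤ) : ℝ) = -1) ∧
      ((quadraticChar L (e 0) : ℤ) : ℝ) = 0 ∧ ∑ v, ((quadraticChar L (e v) : ℤ) : ℝ) = 0 ∧
      (Even n → ∀ u : k, u ≠ 0 → ∀ v, ((quadraticChar L (e (u • v)) : ℤ) : ℝ) =
        ((quadraticChar L (e v) : ℤ) : ℝ)) := by
    intro e
    refine ⟨fun v hv => ?_, by simp, ?_, fun hne u hu v => ?_⟩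
    · rcases quadraticChar_dichotomy (F := L) (a := e v) (by simpa using hv) with h | h
      · exact Or.inl (by rw [h]; simp)
      · exact Or.inr (by rw [h]; simp)
    · rw [← Int.cast_sum]
      exact_mod_cast (Equiv.sum_comp e.toEquiv (fun γ => quadraticChar L γ)).trans
        (quadraticChar_sum_zero hcharL)
    · rw [map_smul, Algebra.smul_def, map_mul, quadraticChar_algebraMap hk u hu, hrank]
      rcases quadraticChar_dichotomy hu with h | h <;> rw [h]
      · simp
      · rw [hne.neg_one_pow, one_mul]
  -- Coordinates in a basis and in its trace-dual basis turn the dot product into the trace of a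
  -- product.
  let e₁ : (Fin n → k) ≃ₗ[k] L := b.equivFun.symm
  let e₂ : (Fin n → k) ≃ₗ[k] L := b.traceDual.equivFun.symm
  have htr : ∀ v w, Algebra.trace k L (e₁ v * e₂ w) = v ⬝ᵥ w := fun v w =>
    trace_equivFun_symm_mul b v w
  have hsum : ∀ s : k, ∑ v, ∑ w, (if v ⬝ᵥ w = s then ((quadraticChar L (e₁ v) : ℤ) : ℝ) *
      ((quadraticChar L (e₂ w) : ℤ) : ℝ) else 0) =
      ((Fintype.card k : ℝ) ^ n - 1) * (quadraticTraceSum L s : ℤ) := by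
    intro s
    have h := sum_sum_trace_mul (L := L) s
    rw [← Equiv.sum_comp e₁.toEquiv, hcardL] at h
    rw [Finset.sum_congr rfl fun v _ => (Equiv.sum_comp e₂.toEquiv _).symm] at h
    have h' := congrArg (Int.cast : ℤ → ℝ) h
    push_cast at h'
    rw [← h']
    refine Finset.sum_congr rfl fun v _ => Finset.sum_congr rfl fun w _ => ?_
    simp only [LinearEquiv.coe_toEquiv, htr]
  have hq1 : (1 : ℝ) ≤ Fintype.card k := by exact_mod_cast Fintype.card_pos
  have hqn : 0 ≤ (Fintype.card k : ℝ) ^ n - 1 := sub_nonneg.2 (one_le_pow₀ hq1)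
  have habs : ∀ (x : ℤ) (j : ℕ), x ^ 2 = (Fintype.card k : ℤ) ^ j →
      |(x : ℝ)| = √(Fintype.card k : ℝ) ^ j := by
    intro x j h
    have h1 : (x : ℝ) ^ 2 = (Fintype.card k : ℝ) ^ j := by exact_mod_cast h
    rw [← Real.sqrt_sq_eq_abs, h1, Real.sqrt_eq_iff_mul_self_eq (by positivity) (by positivity),
      ← mul_pow, Real.mul_self_sqrt (by positivity)]
  obtain ⟨hF, hF0, hFs, hFu⟩ := hgen e₁
  obtain ⟨hG, hG0, hGs, hGu⟩ := hgen e₂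
  refine ⟨fun v => quadraticChar L (e₁ v), fun v => quadraticChar L (e₂ v), hF, hG, hF0, hG0, hFs,
    hGs, fun ho => ?_, fun he => ⟨?_, hFu he, hGu he, ?_⟩⟩
  · rw [hsum, abs_mul, abs_of_nonneg hqn, habs _ (n - 1), mul_comm]
    have := quadraticTraceSum_one_sq_of_odd (L := L) hk (by rw [hrank]; exact ho)
    rwa [hrank] at this
  · have := (quadraticTraceSum_of_even (L := L) hk (by rw [hrank]; exact he)).1
    rw [hrank] at this
    rw [hsum, abs_mul, abs_of_nonneg hqn, habs _ (n - 2) this, mul_comm]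
  · have h := quadraticTraceSum_of_even (L := L) hk (by rw [hrank]; exact he)
    rw [hrank] at h
    rw [hsum, h.2, abs_mul, abs_of_nonneg hqn]
    push_cast
    rw [abs_neg, abs_mul, habs _ (n - 2) h.1, abs_of_nonneg (sub_nonneg.2 hq1)]
    ring

/-! ### Assembly of the bounds -/

theorem mainTheorem3 {R : Type*} [CommRing R] [Finite R] [IsLocalRing R] [IsPrincipalIdealRing R]
    (π : R) (hπ : IsLocalRing.maximalIdeal R = Ideal.span {π})
    (q ℓ : ℕ) (hq : q = Nat.card (IsLocalRing.ResidueField R)) (hq_odd : Odd q)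
    (hℓ : IsLeast {k : ℕ | 0 < k ∧ π ^ k = 0} ℓ) (n : ℕ) :
    (2 ≤ n →
      (Odd n →
        (Um R n).iso =
          1 / 2 * (q : ℝ) ^ ((n - 1) * ℓ) * (1 - (q : ℝ) ^ (-((n : ℝ) - 1) / 2))) ∧
      (Even n →
        (Um R n).iso ≤
          1 / 2 * (q : ℝ) ^ ((n - 1) * ℓ) * (1 - (q : ℝ) ^ (-(n : ℝ) / 2)) ∧
        1 / 2 * (q : ℝ) ^ ((n - 1) * ℓ) * (1 - (q : ℝ) ^ (-((n : ℝ) - 1) / 2)) ≤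
          (Um R n).iso)) ∧
    (3 ≤ n →
      (Odd n →
        1 / 2 * (q : ℝ) ^ ((n - 2) * (ℓ - 1)) *
            (((q : ℝ) ^ (n - 1) - 1) / ((q : ℝ) - 1) - (q : ℝ) ^ ((n : ℝ) / 2 - 1)) ≤
          (Um₀ R n).iso) ∧
      (Even n →
        (Um₀ R n).iso =
          1 / 2 * (q : ℝ) ^ ((n - 2) * (ℓ - 1)) *
            (((q : ℝ) ^ (n - 1) - 1) / ((q : ℝ) - 1) - (q : ℝ) ^ ((n : ℝ) / 2 - 1)))) := by
  have := Fintype.ofFinite R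
  have := Fintype.ofFinite (unimodularTuples R n)
  have := Fintype.ofFinite (IsLocalRing.ResidueField R)
  have hM := natCard_maximalIdeal hπ hℓ
  have hℓ0 : 0 < ℓ := hℓ.1.1
  rw [← hq] at hM
  have hq0 : (0 : ℝ) < q := by
    rw [hq]; exact_mod_cast natCard_residueField_pos R
  have hsqrt : ∀ j : ℕ, √(q : ℝ) ^ j = (q : ℝ) ^ ((j : ℝ) / 2) := fun j => by
    rw [Real.sqrt_eq_rpow, ← Real.rpow_natCast, ← Real.rpow_mul hq0.le]
    congr 1; ring
  have hdeg : ((q : ℝ) * ((q ^ (ℓ - 1) : ℕ) : ℝ)) ^ (n - 1) = (q : ℝ) ^ ((n - 1) * ℓ) := by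
    push_cast
    rw [← pow_succ', Nat.sub_add_cancel hℓ0, ← pow_mul, mul_comm]
  have hMpow : 1 ≤ n → (((q ^ (ℓ - 1) : ℕ) : ℝ)) ^ (n - 1) =
      (q : ℝ) ^ ((n - 1) * ℓ) * (q : ℝ) ^ (-((n : ℝ) - 1)) := fun hn => by
    rw [← hdeg, mul_pow, mul_right_comm, ← Real.rpow_natCast (q : ℝ) (n - 1), ← Real.rpow_add hq0,
      Nat.cast_sub hn, Nat.cast_one, add_neg_cancel, Real.rpow_zero, one_mul]
  refine ⟨fun hn => ?_, fun hn => ?_⟩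
  · have hlow : 1 / 2 * (q : ℝ) ^ ((n - 1) * ℓ) * (1 - (q : ℝ) ^ (-((n : ℝ) - 1) / 2)) ≤
        (Um R n).iso := by
      refine le_trans (le_of_eq ?_) (le_iso_Um (R := R) hn)
      rw [← hq, hM, hdeg, mul_pow, hMpow (by omega), hsqrt, mul_assoc ((q : ℝ) ^ ((n - 1) * ℓ)),
        ← Real.rpow_add hq0, Nat.cast_sub (by omega), Nat.cast_one,
        show -((n : ℝ) - 1) + ((n : ℝ) - 1) / 2 = -((n : ℝ) - 1) / 2 by ring]
      ring
    obtain ⟨F, G, hF, hG, hF0, hG0, hFs, hGs, ho, he⟩ :=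
      exists_sign_functions (IsLocalRing.ResidueField R) (hq ▸ hq_odd) (n := n) (by omega)
    refine ⟨fun hodd => le_antisymm ?_ hlow, fun heven => ⟨?_, hlow⟩⟩
    · refine (iso_Um_le hn hF hG hF0 hG0 hFs hGs (ho hodd)).trans (le_of_eq ?_)
      rw [← hq, hM, hdeg, hMpow (by omega), hsqrt, mul_assoc ((q : ℝ) ^ ((n - 1) * ℓ)),
        ← Real.rpow_add hq0, Nat.cast_sub (by omega), Nat.cast_one,
        show -((n : ℝ) - 1) + ((n : ℝ) - 1) / 2 = -((n : ℝ) - 1) / 2 by ring]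
      ring
    -- In even degree the character sum yields `q^((n-2)/2)`, short of the norm bound by a factor
    -- `√q`, which is the gap between the two bounds.
    · refine (iso_Um_le hn hF hG hF0 hG0 hFs hGs (he heven).1).trans (le_of_eq ?_)
      rw [← hq, hM, hdeg, hMpow (by omega), hsqrt, mul_assoc ((q : ℝ) ^ ((n - 1) * ℓ)),
        ← Real.rpow_add hq0, Nat.cast_sub (by omega), Nat.cast_ofNat,
        show -((n : ℝ) - 1) + ((n : ℝ) - 2) / 2 = -(n : ℝ) / 2 by ring]
      ring
  · have hcast : (((q ^ (ℓ - 1) : ℕ) : ℝ)) ^ (n - 2) = (q : ℝ) ^ ((n - 2) * (ℓ - 1)) := by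
      push_cast
      rw [← pow_mul, mul_comm]
    have hlow : 1 / 2 * (q : ℝ) ^ ((n - 2) * (ℓ - 1)) *
        (((q : ℝ) ^ (n - 1) - 1) / ((q : ℝ) - 1) - (q : ℝ) ^ ((n : ℝ) / 2 - 1)) ≤
        (Um₀ R n).iso := by
      refine le_trans (le_of_eq ?_) (le_iso_Um₀ (R := R) (n := n) (by omega))
      rw [← hq, hM, hcast, hsqrt, Nat.cast_sub (by omega), Nat.cast_ofNat,
        show ((n : ℝ) - 2) / 2 = (n : ℝ) / 2 - 1 by ring]
      ring
    refine ⟨fun _ => hlow, fun heven => le_antisymm ?_ hlow⟩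
    obtain ⟨F, G, hF, hG, hF0, hG0, hFs, hGs, -, he⟩ :=
      exists_sign_functions (IsLocalRing.ResidueField R) (hq ▸ hq_odd) (n := n) (by omega)
    obtain ⟨-, hFu, hGu, hc⟩ := he heven
    refine (iso_Um₀_le (by omega) hF hG hF0 hG0 hFs hGs hFu hGu hc).trans (le_of_eq ?_)
    rw [← hq, hM, hcast, hsqrt, Nat.cast_sub (by omega), Nat.cast_ofNat,
      show ((n : ℝ) - 2) / 2 = (n : ℝ) / 2 - 1 by ring]
    ring
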